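/- Definitions. For a graph $F$ on $[s]=\{1,\dots,s\}$, possibly with loops, and reals $m_1,\dots,m_s>0$, the blow-up $F(m_1,\dots,m_s)$ is the simple graph whose vertex set is a disjoint union $V_1\cup\dots\cup V_s$ with $|V_i|=\lceil m_i\rceil$, in which distinct vertices $x\in V_i$, $y\in V_j$ (possibly $i=j$) are adjacent if and only if $ij\in E(F)$. A $2$-matching is a collection of pairwise vertex-disjoint edges and odd cycles. In a graph whose edges are each coloured with one of the colours $1,\dots,k$, an $\ell$-coloured component is a connected component of the spanning subgraph formed by the edges of colour $\ell$, and an $\ell$-coloured connected matching (respectively $2$-matching) is a matching (respectively $2$-matching) of edges of colour $\ell$ contained in an $\ell$-coloured component. A (2-)matching is *on* the vertices that it covers. Theorem. The following holds with "(2-)matching" read as "matching" throughout, and also with "(2-)matching" read as "2-matching" throughout. Let $s\ge 1$ and $0\le k_0\le k$ be integers and let $\beta\ge\alpha>0$. There is $\varepsilon_0>0$, depending only on $s,k_0,k,\alpha,\beta$, such that the following holds for every $\varepsilon\in(0,\varepsilon_0)$. Set $$\delta=\frac{\varepsilon}{2}\cdot\Big(\frac{\alpha}{56s^3\beta}\Big)^{2k}.$$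 Let $n$ be a non-negative integer, let $N_1,\dots,N_s\in(0,\beta n]$ and $\alpha_1,\dots,\alpha_k\ge\alpha$ be reals, let $F$ be a graph on $[s]$, possibly with loops, and put $\mathcal G=F(N_1+\varepsilon n,\dots,N_s+\varepsilon n)$ and $\mathcal G'=F(N_1,\dots,N_s)$. Suppose that $G$ is a $k$-edge-coloured spanning subgraph of $\mathcal G$ such that - $d_G(u)\ge d_{\mathcal G}(u)-\delta n$ for every vertex $u$; - for every $\ell\in\{1,\dots,k_0\}$, $G$ has no $\ell$-coloured connected (2-)matching on at least $\alpha_\ell n$ vertices; - for every $\ell\in\{k_0+1,\dots,k\}$, $G$ has no $\ell$-coloured connected (2-)matching on at least $\alpha_\ell n$ vertices contained in a non-bipartite $\ell$-coloured component. Then there is a $k$-edge-colouring $G'$ of $\mathcal G'$ with the last two properties (that is, with $G'$ in place of $G$). Moreover, such a $G'$ can be chosen so that it contains an induced subgraph of $G$ with exactly $\lceil N_i\rceil$ vertices in the set replacing $i$, for each $i\in[s]$: there is an injection $f$ from $V(\mathcal G')$ to $V(\mathcal G)$ that maps the set replacing $i$ in $\mathcal G'$ into the set replacing $i$ in $\mathcal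 G$, for each $i$, and such that whenever $f(x)f(y)$ is an edge of $G$, $xy$ is an edge of $\mathcal G'$ and has in $G'$ the colour that $f(x)f(y)$ has in $G$. -/

import Mathlib

/-- A graph on the vertex set `V` in which loops are allowed (and multiple edges are not). -/
structure LoopGraph (V : Type*) where
  /-- The adjacency relation; `Adj v v` means that there is a loop at `v`. -/
  Adj : V → V → Prop
  symm : ∀ v w, Adj v w → Adj w v

/-- The blow-up `F(m₁, …, mₛ)`: the vertex `i` of `F` is replaced by a set of `⌈mᵢ⌉` vertices (the
vertices of the blow-up whose first component is `i`), and two distinct vertices are adjacent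
exactly when they come from vertices `i`, `j` of `F` (possibly `i = j`) with `ij ∈ E(F)`. -/
def LoopGraph.blowUp {s : ℕ} (F : LoopGraph (Fin s)) (m : Fin s → ℝ) :
    SimpleGraph (Σ i : Fin s, Fin ⌈m i⌉₊) where
  Adj x y := x ≠ y ∧ F.Adj x.1 y.1
  symm := ⟨fun _ _ h => ⟨h.1.symm, F.symm _ _ h.2⟩⟩
  loopless := ⟨fun _ h => h.1 rfl⟩

/-- The subgraph `P` of `H` is a single edge. -/
def IsEdgePiece {V : Type*} {H : SimpleGraph V} (P : H.Subgraph) : Prop :=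
  ∃ (u v : V) (h : H.Adj u v), P = H.subgraphOfAdj h

/-- The subgraph `P` of `H` is an odd cycle. -/
def IsOddCyclePiece {V : Type*} {H : SimpleGraph V} (P : H.Subgraph) : Prop :=
  ∃ (u : V) (c : H.Walk u u), c.IsCycle ∧ Odd c.length ∧ P = c.toSubgraph

/-- A `2`-matching in `H`: a collection of pairwise vertex-disjoint edges and odd cycles. -/
def IsTwoMatching {V : Type*} {H : SimpleGraph V} (M : Set H.Subgraph) : Prop :=
  (∀ P ∈ M, IsEdgePiece P ∨ IsOddCyclePiece P) ∧
    M.Pairwise fun P Q => Disjoint P.verts Q.verts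

/-- The two notions of matching that are considered in parallel. -/
inductive MatchingKind
  | matching
  | twoMatching

/-- `S` is the set of vertices covered by some matching (respectively some `2`-matching) of `H`. -/
def IsCoveredSet {V : Type*} (κ : MatchingKind) (H : SimpleGraph V) (S : Set V) : Prop :=
  match κ with
  | .matching => ∃ M : H.Subgraph, M.IsMatching ∧ M.verts = S
  | .twoMatching => ∃ M : Set H.Subgraph, IsTwoMatching M ∧ ⋃ P ∈ M, P.verts = S

/-- `H` has a connected (`2`-)matching on at least `x` vertices: a (`2`-)matching covering at
least `x` vertices and contained in a connected component of `H`. -/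
def HasConnectedMatching {V : Type*} (κ : MatchingKind) (H : SimpleGraph V) (x : ℝ) : Prop :=
  ∃ (K : H.ConnectedComponent) (S : Set V),
    S ⊆ K.supp ∧ IsCoveredSet κ H S ∧ x ≤ (S.ncard : ℝ)

/-- `H` has a connected (`2`-)matching on at least `x` vertices contained in a non-bipartite
component of `H`. -/
def HasNonbipartiteConnectedMatching {V : Type*} (κ : MatchingKind) (H : SimpleGraph V)
    (x : ℝ) : Prop :=
  ∃ (K : H.ConnectedComponent) (S : Set V),
    ¬ K.toSimpleGraph.IsBipartite ∧ S ⊆ K.supp ∧ IsCoveredSet κ H S ∧ x ≤ (S.ncard : ℝ)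

/-- For a `k`-edge-colouring `C` of `G` (colours are numbered from `0`, so that the first `k₀`
colours are those with `ℓ < k₀`): there is no `ℓ`-coloured connected (`2`-)matching on at least
`x ℓ` vertices for the first `k₀` colours `ℓ`, and for the remaining colours `ℓ` there is no
such (`2`-)matching contained in a non-bipartite `ℓ`-coloured component. -/
def AvoidsConnectedMatchings {V : Type*} {G : SimpleGraph V} {k : ℕ} (κ : MatchingKind) (k₀ : ℕ)
    (C : G.EdgeLabeling (Fin k)) (x : Fin k → ℝ) : Prop :=
  (∀ ℓ : Fin k, (ℓ : ℕ) < k₀ → ¬ HasConnectedMatching κ (C.labelGraph ℓ) (x ℓ)) ∧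
    ∀ ℓ : Fin k, k₀ ≤ (ℓ : ℕ) → ¬ HasNonbipartiteConnectedMatching κ (C.labelGraph ℓ) (x ℓ)

/-!
The missing edges of `G` get the colours of *saturated* colour graphs. In each colour `ℓ`, a duality
theorem gives, for every component, a set `U` and a partition `p` (`IsBarrier`) such that all edges
that meet `U` or lie inside a class of `p` can be added without enlarging the largest
(`2`-)matching. For matchings, `U` is a Tutte set of the component with additional universal
vertices and `p` is the partition of the rest into components (`exists_isBarrier_matching`). For
`2`-matchings, `U` and `p` come from an optimal half-integral vertex cover
(`exists_weight_le_twoMatching`), which is found by Hall's theorem. A component that is allowed to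
have large matchings because it is bipartite is completed to a complete bipartite graph. This is
`exists_saturation`.

Call a pair of vertices bad if it is an edge of the blow-up but of no saturated colour. Bad pairs
are missing from `G`, so each vertex lies in at most `δ n` of them, and it is enough to delete few
vertices that meet all bad pairs. In each colour, the non-adjacent pairs of the saturated graph can
be separated at random: there is a random pair of sets `P`, `Q` without edges between them such that
each non-adjacent pair is in `P × Q` with probability at least `1 / 8`, regardless of the number of
components and classes (`isRandomlySeparable_saturatedAdj`). Likewise, the pairs adjacent in the
blow-up are caught with probability at least `1 / s ^ 2`. If bad pairs `xᵢyᵢ` are such that no cross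
pair `xᵢyⱼ` is bad, then the events that `xᵢyᵢ` is separated in all colours are disjoint, so there
are at most `s ^ 2 * 8 ^ k` of them (`card_le_prod_of_isRandomlySeparable`). For a maximal family of
this kind, each bad pair contains a bad partner of some `xᵢ` or `yᵢ`
(`exists_finset_forall_adj_exists_adj`). Hence `2 s ^ 2 8 ^ k δ n ≤ ε n / 2` vertices meet all bad
pairs, and each part has enough surplus vertices to avoid them. This estimate uses `0 < k`; without
colours, the degree condition leaves no edges to colour (`blowUp_eq_bot_of_degree_le`).
-/

open SimpleGraph

/-! ### Covered sets -/

/-- `S` is the vertex set of an edge or of an odd cycle of `H`. -/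
def IsPieceSet {V : Type*} (H : SimpleGraph V) (S : Set V) : Prop :=
  (∃ u v, H.Adj u v ∧ S = {u, v}) ∨
    ∃ (u : V) (c : H.Walk u u), c.IsCycle ∧ Odd c.length ∧ S = {x | x ∈ c.support}

lemma isPieceSet_iff {V : Type*} {H : SimpleGraph V} {S : Set V} :
    IsPieceSet H S ↔ ∃ P : H.Subgraph, (IsEdgePiece P ∨ IsOddCyclePiece P) ∧ P.verts = S := by
  constructor
  · rintro (⟨u, v, h, rfl⟩ | ⟨u, c, hc, ho, rfl⟩)
    · exact ⟨_, Or.inl ⟨u, v, h, rfl⟩, rfl⟩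
    · exact ⟨_, Or.inr ⟨u, c, hc, ho, rfl⟩, by ext; simp⟩
  · rintro ⟨P, ⟨u, v, h, rfl⟩ | ⟨u, c, hc, ho, rfl⟩, rfl⟩
    · exact Or.inl ⟨u, v, h, rfl⟩
    · exact Or.inr ⟨u, c, hc, ho, by ext; simp⟩

/-- `2`-matchings in terms of the vertex sets of their pieces, which alone determine which sets a
`2`-matching covers. -/
lemma isCoveredSet_twoMatching_iff {V : Type*} {H : SimpleGraph V} {A : Set V} :
    IsCoveredSet .twoMatching H A ↔ ∃ 𝒮 : Set (Set V),
      (∀ S ∈ 𝒮, IsPieceSet H S) ∧ 𝒮.PairwiseDisjoint id ∧ ⋃₀ 𝒮 = A := by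
  constructor
  · rintro ⟨M, ⟨hM, hd⟩, rfl⟩
    refine ⟨Subgraph.verts '' M, ?_, ?_, by rw [Set.sUnion_image]⟩
    · rintro _ ⟨P, hP, rfl⟩
      exact isPieceSet_iff.2 ⟨P, hM P hP, rfl⟩
    · rintro _ ⟨P, hP, rfl⟩ _ ⟨Q, hQ, rfl⟩ hne
      exact hd hP hQ (fun h => hne (by rw [h]))
  · rintro ⟨𝒮, hp, hd, rfl⟩
    choose g hg hgv using fun S : 𝒮 => isPieceSet_iff.1 (hp S.1 S.2)
    refine ⟨Set.range g, ⟨?_, ?_⟩, ?_⟩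
    · rintro _ ⟨S, rfl⟩
      exact hg S
    · rintro _ ⟨S, rfl⟩ _ ⟨S', rfl⟩ hne
      rw [hgv, hgv]
      exact hd S.2 S'.2 (fun h => hne (by rw [Subtype.ext h]))
    · ext x
      simp [hgv]

lemma IsPieceSet.map {V W : Type*} {H : SimpleGraph V} {H' : SimpleGraph W} {A : Set V}
    (hA : IsPieceSet H A) {f : V → W} (hf : f.Injective)
    (h : ∀ x ∈ A, ∀ y ∈ A, H.Adj x y → H'.Adj (f x) (f y)) : IsPieceSet H' (f '' A) := by
  rcases hA with ⟨u, v, huv, rfl⟩ | ⟨u, c, hc, ho, rfl⟩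
  · exact Or.inl ⟨f u, f v, h u (by simp) v (by simp) huv, by simp [Set.image_pair]⟩
  · right
    have ht : ∀ e ∈ c.edges, e ∈ (H'.comap f).edgeSet := by
      intro e he
      induction e using Sym2.inductionOn with
      | hf x y =>
        exact h x (c.fst_mem_support_of_mem_edges he) y (c.snd_mem_support_of_mem_edges he)
          (c.adj_of_mem_edges he)
    let φ : H'.comap f →g H' := ⟨f, fun h => h⟩
    refine ⟨f u, (c.transfer _ ht).map φ, (hc.transfer ht).map hf, ?_, ?_⟩
    · simpa using ho
    · ext x
      simp only [Walk.support_map, Walk.support_transfer, List.mem_map]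
      rfl

/-- Covered sets are carried along injections that preserve the edges inside the set. -/
lemma IsCoveredSet.map {V W : Type*} {κ : MatchingKind} {H : SimpleGraph V} {H' : SimpleGraph W}
    {A : Set V} (hA : IsCoveredSet κ H A) {f : V → W} (hf : f.Injective)
    (h : ∀ x ∈ A, ∀ y ∈ A, H.Adj x y → H'.Adj (f x) (f y)) : IsCoveredSet κ H' (f '' A) := by
  cases κ with
  | matching =>
    obtain ⟨M, hM, rfl⟩ := hA
    refine ⟨⟨f '' M.verts, fun a b => ∃ x y, M.Adj x y ∧ f x = a ∧ f y = b, ?_, ?_, ?_⟩, ?_, rfl⟩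
    · rintro _ _ ⟨x, y, hxy, rfl, rfl⟩
      exact h x (M.edge_vert hxy) y (M.edge_vert hxy.symm) hxy.adj_sub
    · rintro _ _ ⟨x, y, hxy, rfl, rfl⟩
      exact ⟨x, M.edge_vert hxy, rfl⟩
    · constructor
      rintro _ _ ⟨x, y, hxy, rfl, rfl⟩
      exact ⟨y, x, hxy.symm, rfl, rfl⟩
    · rintro _ ⟨x, hx, rfl⟩
      obtain ⟨y, hy, hy'⟩ := hM hx
      refine ⟨f y, ⟨x, y, hy, rfl, rfl⟩, ?_⟩
      rintro _ ⟨x', y', hxy', hx', rfl⟩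
      rw [hf hx'] at hxy'
      rw [hy' y' hxy']
  | twoMatching =>
    obtain ⟨𝒮, hp, hd, rfl⟩ := isCoveredSet_twoMatching_iff.1 hA
    refine isCoveredSet_twoMatching_iff.2 ⟨Set.image f '' 𝒮, ?_, ?_, ?_⟩
    · rintro _ ⟨S, hS, rfl⟩
      exact (hp S hS).map hf fun x hx y hy =>
        h x (Set.mem_sUnion_of_mem hx hS) y (Set.mem_sUnion_of_mem hy hS)
    · rintro _ ⟨S, hS, rfl⟩ _ ⟨S', hS', rfl⟩ hne
      exact (Set.disjoint_image_iff hf).2 (hd hS hS' fun h => hne (by rw [h]))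
    · rw [Set.image_sUnion, Set.sUnion_image]

lemma IsCoveredSet.mono {V : Type*} {κ : MatchingKind} {H H' : SimpleGraph V}
    {A : Set V} (hA : IsCoveredSet κ H A)
    (h : ∀ x ∈ A, ∀ y ∈ A, H.Adj x y → H'.Adj x y) : IsCoveredSet κ H' A := by
  simpa using hA.map Function.injective_id h

lemma IsCoveredSet.exists_adj {V : Type*} {κ : MatchingKind} {H : SimpleGraph V}
    {A : Set V} (hA : IsCoveredSet κ H A) {x : V} (hx : x ∈ A) : ∃ y, H.Adj x y := by
  cases κ with
  | matching =>
    obtain ⟨M, hM, rfl⟩ := hA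
    obtain ⟨y, hy, -⟩ := hM hx
    exact ⟨y, hy.adj_sub⟩
  | twoMatching =>
    obtain ⟨𝒮, hp, hd, rfl⟩ := isCoveredSet_twoMatching_iff.1 hA
    obtain ⟨S, hS, hxS⟩ := hx
    rcases hp S hS with ⟨u, v, huv, rfl⟩ | ⟨u, c, hc, ho, rfl⟩
    · rcases hxS with rfl | rfl
      · exact ⟨_, huv⟩
      · exact ⟨_, huv.symm⟩
    · obtain ⟨e, he, hxe⟩ := (Walk.mem_support_iff_exists_mem_edges_of_not_nil hc.not_nil).1 hxS
      induction e using Sym2.inductionOn with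
      | hf y z =>
        have hyz := c.adj_of_mem_edges he
        rcases Sym2.mem_iff.1 hxe with rfl | rfl
        · exact ⟨_, hyz⟩
        · exact ⟨_, hyz.symm⟩

lemma isCoveredSet_empty {V : Type*} (κ : MatchingKind) (H : SimpleGraph V) :
    IsCoveredSet κ H ∅ := by
  cases κ with
  | matching => exact ⟨⊥, by simp [Subgraph.IsMatching], rfl⟩
  | twoMatching => exact ⟨∅, by simp [IsTwoMatching], by simp⟩

lemma IsCoveredSet.union_piece {V : Type*} {H : SimpleGraph V} {A S : Set V}
    (hA : IsCoveredSet .twoMatching H A) (hS : IsPieceSet H S) (hd : Disjoint A S) :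
    IsCoveredSet .twoMatching H (A ∪ S) := by
  obtain ⟨𝒮, hp, hd', rfl⟩ := isCoveredSet_twoMatching_iff.1 hA
  refine isCoveredSet_twoMatching_iff.2 ⟨insert S 𝒮, ?_, ?_, ?_⟩
  · rintro T (rfl | hT)
    · exact hS
    · exact hp T hT
  · refine hd'.insert fun T hT _ => ?_
    exact (hd.mono_left (Set.subset_sUnion_of_mem hT)).symm
  · rw [Set.sUnion_insert, Set.union_comm]

lemma IsCoveredSet.union {V : Type*} {H : SimpleGraph V} {A B : Set V}
    (hA : IsCoveredSet .twoMatching H A) (hB : IsCoveredSet .twoMatching H B)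
    (hd : Disjoint A B) : IsCoveredSet .twoMatching H (A ∪ B) := by
  obtain ⟨𝒮, hp, hd', rfl⟩ := isCoveredSet_twoMatching_iff.1 hA
  obtain ⟨𝒯, hq, hd'', rfl⟩ := isCoveredSet_twoMatching_iff.1 hB
  refine isCoveredSet_twoMatching_iff.2 ⟨𝒮 ∪ 𝒯, ?_, ?_, Set.sUnion_union 𝒮 𝒯⟩
  · rintro T (hT | hT)
    · exact hp T hT
    · exact hq T hT
  · rw [Set.pairwiseDisjoint_union]
    exact ⟨hd', hd'', fun S hS T hT _ =>
      hd.mono (Set.subset_sUnion_of_mem hS) (Set.subset_sUnion_of_mem hT)⟩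

/-! ### Two-matchings from partial injections -/

lemma isCoveredSet_image_Iio_even {V : Type*} {H : SimpleGraph V} (a : ℕ → V) (r : ℕ)
    (hinj : Set.InjOn a (Set.Iio (r + r))) (hadj : ∀ i, H.Adj (a i) (a (i + 1))) :
    IsCoveredSet .twoMatching H (a '' Set.Iio (r + r)) := by
  induction r with
  | zero => simpa using isCoveredSet_empty _ H
  | succ r ih =>
    have hsub : Set.Iio (r + r) ⊆ Set.Iio (r + 1 + (r + 1)) := by
      intro i hi
      simp only [Set.mem_Iio] at *
      omega
    have h1 := (ih (hinj.mono hsub)).union_piece (S := {a (r + r), a (r + r + 1)})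
      (Or.inl ⟨_, _, hadj (r + r), rfl⟩) (by
        rw [Set.disjoint_left]
        rintro _ ⟨i, hi, rfl⟩ (h | h)
        · have := hinj (hsub hi) (by simp; omega) h
          simp only [Set.mem_Iio] at hi
          omega
        · have := hinj (hsub hi) (by simp; omega) h
          simp only [Set.mem_Iio] at hi
          omega)
    convert h1 using 1
    rw [← Set.image_pair, ← Set.image_union]
    congr 1
    ext i
    simp only [Set.mem_Iio, Set.mem_union, Set.mem_insert_iff, Set.mem_singleton_iff]
    omega

lemma isPieceSet_image_Iio_odd {V : Type*} {H : SimpleGraph V} (a : ℕ → V) (n : ℕ)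
    (ho : Odd n) (hinj : Set.InjOn a (Set.Iio n)) (hadj : ∀ i, H.Adj (a i) (a (i + 1)))
    (hcl : a n = a 0) : IsPieceSet H (a '' Set.Iio n) := by
  have h3 : 3 ≤ n := by
    rcases n with _ | _ | _ | n
    · simp at ho
    · have := hadj 0
      rw [zero_add, show a 1 = a 0 from hcl] at this
      exact (H.irrefl this).elim
    · exact absurd ho (by decide)
    · omega
  obtain ⟨m, rfl⟩ := Nat.exists_eq_add_of_le' h3
  have hadj' : ∀ {i j : Fin (m + 3)}, (cycleGraph (m + 3)).Adj i j → H.Adj (a i) (a j) := by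
    have key : ∀ i j : Fin (m + 3), (i - j).val = 1 → H.Adj (a j) (a i) := by
      intro i j hij
      have hi : i = j + 1 := by
        have : i - j = 1 := by
          apply Fin.ext
          rw [hij]
          rfl
        rw [← this]
        abel
      subst hi
      rcases eq_or_ne j (Fin.last _) with rfl | hj
      · have := hadj (m + 2)
        rw [show m + 2 + 1 = m + 3 from rfl, hcl] at this
        simpa using this
      · rw [Fin.val_add_one_of_lt (Fin.lt_last_iff_ne_last.2 hj)]
        exact hadj j
    intro i j hij
    rcases cycleGraph_adj'.1 hij with h | h
    · exact (key _ _ h).symm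
    · exact key _ _ h
  let φ : cycleGraph (m + 3) →g H := ⟨fun i => a i, hadj'⟩
  have hφ : Function.Injective φ := fun i j hij => Fin.ext (hinj i.2 j.2 hij)
  refine Or.inr ⟨_, (cycleGraph.cycle m).map φ, cycleGraph.isCycle_cycle.map hφ, ?_, ?_⟩
  · simpa using ho
  · have hall : ∀ i : Fin (m + 3), i ∈ (cycleGraph.cycle m).support := by
      intro i
      have := (cycleGraph.cycle m).getVert_mem_support (m + 3 - i)
      rw [cycleGraph.getVert_cycle (by omega)] at this
      convert this using 1
      apply Fin.ext
      simp only
      rw [show m + 3 - (m + 3 - (i : ℕ)) = i by omega, Nat.mod_eq_of_lt i.2]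
    ext x
    simp only [Walk.support_map, List.mem_map, Set.mem_image, Set.mem_Iio]
    constructor
    · rintro ⟨i, hi, rfl⟩
      exact ⟨⟨i, hi⟩, hall _, rfl⟩
    · rintro ⟨i, -, rfl⟩
      exact ⟨i, i.2, rfl⟩

lemma isCoveredSet_image_Iio_of_closed {V : Type*} {H : SimpleGraph V} (a : ℕ → V) (n : ℕ)
    (hinj : Set.InjOn a (Set.Iio n)) (hadj : ∀ i, H.Adj (a i) (a (i + 1)))
    (hcl : a n = a 0) : IsCoveredSet .twoMatching H (a '' Set.Iio n) := by
  rcases Nat.even_or_odd n with ⟨r, rfl⟩ | ho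
  · exact isCoveredSet_image_Iio_even a r hinj hadj
  · simpa using (isCoveredSet_empty _ H).union_piece (isPieceSet_image_Iio_odd a n ho hinj hadj hcl)
      (by simp)

/-- A partial injection `f` along the edges of `H` decomposes into directed paths and cycles. On a
path one splits off the first edge; an even cycle splits into edges, and an odd cycle is a piece
of a `2`-matching itself. -/
lemma exists_isCoveredSet_of_injOn {V : Type*} {H : SimpleGraph V} (f : V → V) (D : Finset V)
    (hinj : Set.InjOn f D) (hadj : ∀ v ∈ D, H.Adj v (f v)) :
    ∃ B : Set V, B ⊆ D ∪ f '' D ∧ B.Finite ∧ IsCoveredSet .twoMatching H B ∧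
      D.card ≤ B.ncard := by
  classical
  induction hn : D.card using Nat.strong_induction_on generalizing D with
  | _ n ih =>
  rcases D.eq_empty_or_nonempty with rfl | hne
  · exact ⟨∅, by simp, by simp, isCoveredSet_empty _ H, by simp [← hn]⟩
  by_cases h1 : ∃ v ∈ D, v ∉ f '' D
  -- A path starts at `v`: split off the edge from `v` to `f v`.
  · obtain ⟨v, hv, hvf⟩ := h1
    set D' := (D.erase v).erase (f v) with hD'
    have hsub : D' ⊆ D := (Finset.erase_subset _ _).trans (Finset.erase_subset _ _)
    have hlt : D'.card < n := by
      rw [← hn]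
      exact (Finset.card_le_card (Finset.erase_subset _ _)).trans_lt
        (Finset.card_erase_lt_of_mem hv)
    have hle : n ≤ D'.card + 2 := by
      have h1 := Finset.pred_card_le_card_erase (s := D) (a := v)
      have h2 : _ ≤ D'.card := Finset.pred_card_le_card_erase (s := D.erase v) (a := f v)
      omega
    obtain ⟨B, hB, hfin, hBc, hBn⟩ := ih _ hlt D' (hinj.mono (by exact_mod_cast hsub))
      (fun v hv => hadj v (hsub hv)) rfl
    have hd : Disjoint B {v, f v} := by
      rw [Set.disjoint_left]
      intro x hx hx'
      rcases hB hx with h | ⟨y, hy, rfl⟩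
      · rcases hx' with rfl | hx'
        · simp [hD'] at h
        · obtain rfl : x = f v := hx'
          simp [hD'] at h
      · have hyD : y ∈ D := hsub hy
        rcases hx' with h | h
        · exact hvf ⟨y, hyD, h⟩
        · have : y = v := hinj hyD hv h
          subst this
          simp [hD'] at hy
    refine ⟨B ∪ {v, f v}, ?_, hfin.union (by simp),
      hBc.union_piece (Or.inl ⟨_, _, hadj v hv, rfl⟩) hd, ?_⟩
    · refine Set.union_subset (hB.trans ?_) ?_
      · exact Set.union_subset_union (by exact_mod_cast hsub)
          (Set.image_mono (by exact_mod_cast hsub))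
      · rintro x (rfl | rfl)
        · exact Or.inl hv
        · exact Or.inr ⟨v, hv, rfl⟩
    · rw [Set.ncard_union_eq hd hfin (by simp), Set.ncard_pair (hadj v hv).ne]
      omega
  -- Otherwise `f` permutes `D`: split off an orbit.
  · push Not at h1
    have himg : D = D.image f := Finset.eq_of_subset_of_card_le
      (fun v hv => by simpa using h1 v hv) Finset.card_image_le
    have hmaps : ∀ v ∈ D, f v ∈ D := fun v hv => by
      rw [himg]
      exact Finset.mem_image_of_mem f hv
    obtain ⟨v, hv⟩ := hne
    let g : D → D := fun x => ⟨f x, hmaps x x.2⟩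
    have hg : Function.Injective g := fun x y hxy =>
      Subtype.ext (hinj x.2 y.2 (congrArg Subtype.val hxy))
    let a : ℕ → V := fun i => (g^[i] ⟨v, hv⟩ : D)
    set m := Function.minimalPeriod g ⟨v, hv⟩ with hm
    have hm0 : 0 < m := Function.minimalPeriod_pos_of_mem_periodicPts (hg.mem_periodicPts _)
    have hainj : Set.InjOn a (Set.Iio m) := fun i hi j hj hij =>
      Function.iterate_injOn_Iio_minimalPeriod hi hj (Subtype.ext hij)
    have hsucc : ∀ i, a (i + 1) = f (a i) := fun i => by
      simp only [a, Function.iterate_succ_apply']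
      rfl
    have haD : ∀ i, a i ∈ D := fun i => (g^[i] ⟨v, hv⟩ : D).2
    have haadj : ∀ i, H.Adj (a i) (a (i + 1)) := fun i => by
      rw [hsucc]
      exact hadj _ (haD i)
    have hcl : a m = a 0 := by
      simp only [a, hm, Function.iterate_minimalPeriod]
      rfl
    have hO := isCoveredSet_image_Iio_of_closed a m hainj haadj hcl
    set O : Finset V := (Finset.range m).image a with hOdef
    have hOc : (O : Set V) = a '' Set.Iio m := by
      rw [hOdef, Finset.coe_image, Finset.coe_range]
    have hOD : O ⊆ D := by
      intro x hx
      obtain ⟨i, -, rfl⟩ := Finset.mem_image.1 hx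
      exact haD i
    have hvO : v ∈ O := Finset.mem_image.2 ⟨0, by simpa using hm0, rfl⟩
    -- The orbit is closed under taking preimages.
    have hpre : ∀ y ∈ D, f y ∈ O → y ∈ O := by
      intro y hy hyO
      obtain ⟨i, hi, hi'⟩ := Finset.mem_image.1 hyO
      rcases i with _ | i
      · have h0 : a (m - 1 + 1) = f y := by
          rw [Nat.sub_add_cancel hm0, hcl, hi']
        rw [hsucc] at h0
        rw [← hinj (haD _) hy h0]
        exact Finset.mem_image_of_mem _ (by simp; omega)
      · rw [hsucc] at hi'
        rw [← hinj (haD _) hy hi']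
        exact Finset.mem_image_of_mem _ (by simp at hi ⊢; omega)
    have hcard : (D \ O).card + O.card = n := by
      rw [Finset.card_sdiff_add_card_eq_card hOD, hn]
    have hOpos : 0 < O.card := Finset.card_pos.2 ⟨v, hvO⟩
    obtain ⟨B, hB, hfin, hBc, hBn⟩ := ih _ (by omega) (D \ O)
      (hinj.mono (by exact_mod_cast Finset.sdiff_subset))
      (fun v hv => hadj v (Finset.sdiff_subset hv)) rfl
    have hd : Disjoint B (O : Set V) := by
      rw [Set.disjoint_left]
      intro x hx hx'
      rcases hB hx with h | ⟨y, hy, rfl⟩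
      · exact (Finset.mem_sdiff.1 h).2 hx'
      · have hy' := Finset.mem_sdiff.1 hy
        exact hy'.2 (hpre y hy'.1 hx')
    rw [← hOc] at hO
    refine ⟨B ∪ O, Set.union_subset (hB.trans ?_) ?_, hfin.union O.finite_toSet,
      hBc.union hO hd, ?_⟩
    · have : ((D \ O : Finset V) : Set V) ⊆ D := by exact_mod_cast Finset.sdiff_subset
      exact Set.union_subset_union this (Set.image_mono this)
    · exact fun x hx => Or.inl (hOD hx)
    · rw [Set.ncard_union_eq hd hfin O.finite_toSet, Set.ncard_coe_finset]
      omega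

/-! ### Weighted duality for two-matchings -/

/-- A fractional vertex cover (scaled by `2`) has weight at least `S.ncard` on a piece `S`. -/
lemma IsPieceSet.ncard_le_sum {V : Type*} {T : SimpleGraph V} {S : Set V}
    (hS : IsPieceSet T S) (w : V → ℕ) (hw : ∀ x y, T.Adj x y → 2 ≤ w x + w y) :
    ∃ S' : Finset V, (S' : Set V) = S ∧ S'.card ≤ ∑ v ∈ S', w v := by
  classical
  rcases hS with ⟨u, v, huv, rfl⟩ | ⟨u, c, hc, -, rfl⟩
  · refine ⟨{u, v}, by simp, ?_⟩
    rw [Finset.card_pair huv.ne, Finset.sum_pair huv.ne]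
    exact hw u v huv
  · refine ⟨c.support.tail.toFinset, ?_, ?_⟩
    · ext x
      simp only [List.coe_toFinset, Set.mem_ofPred_eq]
      refine ⟨List.mem_of_mem_tail, fun hx => ?_⟩
      rw [← c.cons_tail_support, List.mem_cons] at hx
      rcases hx with rfl | hx
      · exact c.end_mem_tail_support hc.not_nil
      · exact hx
    · rw [List.toFinset_card_of_nodup hc.support_nodup, List.sum_toFinset _ hc.support_nodup]
      -- Summing `w` over the two ends of all darts counts every vertex of the cycle twice.
      have h1 : (c.darts.map fun d => 2).sum ≤ (c.darts.map fun d => w d.fst + w d.snd).sum :=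
        List.sum_le_sum fun d _ => hw _ _ d.adj
      have h2 : (c.darts.map fun d => w d.fst + w d.snd).sum =
          ((c.darts.map (·.fst)).map w).sum + ((c.darts.map (·.snd)).map w).sum := by
        rw [List.map_map, List.map_map, ← List.sum_map_add]
        rfl
      have h3 : ((c.darts.map (·.fst)).map w).sum = ((c.darts.map (·.snd)).map w).sum := by
        have h4 := congrArg (fun l => (l.map w).sum)
          (c.map_fst_darts_append.trans c.cons_map_snd_darts.symm)
        simp only [List.map_append, List.sum_append, List.map_cons, List.sum_cons,
          List.map_nil, List.sum_nil] at h4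
        omega
      rw [h2, h3, c.map_snd_darts] at h1
      simp only [List.map_const', List.sum_replicate, Walk.length_darts, smul_eq_mul] at h1
      rw [List.length_tail, Walk.length_support]
      change _ ≤ (c.support.tail.map w).sum
      omega

lemma IsCoveredSet.ncard_le_sum {V : Type*} [Fintype V] {T : SimpleGraph V} {A : Set V}
    (hA : IsCoveredSet .twoMatching T A) (w : V → ℕ)
    (hw : ∀ x y, T.Adj x y → 2 ≤ w x + w y) : A.ncard ≤ ∑ v, w v := by
  classical
  obtain ⟨𝒮, hp, hd, rfl⟩ := isCoveredSet_twoMatching_iff.1 hA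
  choose! g hg hgc using fun S hS => (hp S hS).ncard_le_sum w hw
  set F := 𝒮.toFinite.toFinset with hF
  have hmem : ∀ S, S ∈ F ↔ S ∈ 𝒮 := fun S => by simp [hF]
  have hun : ((F.biUnion g : Finset V) : Set V) = ⋃₀ 𝒮 := by
    ext x
    simp only [Finset.coe_biUnion, Set.mem_iUnion, Set.mem_sUnion, Finset.mem_coe, hmem]
    constructor
    · rintro ⟨S, hS, hx⟩
      exact ⟨S, hS, by rw [← hg S hS]; exact hx⟩
    · rintro ⟨S, hS, hx⟩
      exact ⟨S, hS, by rw [← hg S hS] at hx; exact hx⟩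
  have hdis : ((F : Set (Set V))).PairwiseDisjoint g := by
    intro S hS S' hS' hne
    rw [Finset.mem_coe, hmem] at hS hS'
    have := hd hS hS' hne
    simp only [Function.onFun, id] at this ⊢
    rwa [← Finset.disjoint_coe, hg S hS, hg S' hS']
  rw [← hun, Set.ncard_coe_finset]
  calc (F.biUnion g).card ≤ ∑ S ∈ F, (g S).card := Finset.card_biUnion_le
    _ ≤ ∑ S ∈ F, ∑ v ∈ g S, w v := Finset.sum_le_sum fun S hS => hgc S ((hmem S).1 hS)
    _ = ∑ v ∈ F.biUnion g, w v := (Finset.sum_biUnion hdis).symm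
    _ ≤ ∑ v, w v := Finset.sum_le_sum_of_subset (Finset.subset_univ _)

/-- The duality theorem for `2`-matchings: some half-integral vertex cover (`w / 2`) has total
weight at most half the number of vertices covered by some `2`-matching. The cover comes from a
set of largest Hall deficiency, and the `2`-matching from Hall's theorem. -/
lemma exists_weight_le_twoMatching {V : Type*} [Fintype V] (H : SimpleGraph V) :
    ∃ w : V → ℕ, (∀ v, w v ≤ 2) ∧ (∀ x y, H.Adj x y → 2 ≤ w x + w y) ∧
      ∃ B, IsCoveredSet .twoMatching H B ∧ ∑ v, w v ≤ B.ncard := by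
  classical
  -- `N A` is the set of neighbours of vertices of `A`, including those inside `A`.
  let N : Finset V → Finset V := fun A => {b | ∃ a ∈ A, H.Adj a b}
  obtain ⟨A, -, hA⟩ := Finset.exists_max_image (Finset.univ : Finset (Finset V))
    (fun A => (A.card : ℤ) - (N A).card) ⟨∅, Finset.mem_univ _⟩
  have hNA : (N A).card ≤ A.card := by
    have := hA ∅ (Finset.mem_univ _)
    simp [N] at this ⊢
    exact this
  set d := A.card - (N A).card with hd
  -- Hall's condition holds after adding `d` dummy partners that are acceptable to every vertex.
  obtain ⟨F, hF, hFr⟩ := (Fintype.all_card_le_filter_rel_iff_exists_injective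
    (fun (a : V) (b : V ⊕ Fin d) => ∀ v, b = Sum.inl v → H.Adj a v)).1 (by
      intro A'
      rcases A'.eq_empty_or_nonempty with rfl | ⟨a, ha⟩
      · simp
      have h1 := hA A' (Finset.mem_univ _)
      calc A'.card ≤ (N A').card + d := by
            have h2 : ((d : ℕ) : ℤ) = A.card - (N A).card := by omega
            omega
        _ = ((N A').disjSum (Finset.univ : Finset (Fin d))).card := by
            rw [Finset.card_disjSum, Finset.card_fin]
        _ ≤ _ := by
            refine Finset.card_le_card ?_
            intro b hb
            rw [Finset.mem_filter]
            refine ⟨Finset.mem_univ _, ?_⟩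
            rcases b with b | b
            · obtain ⟨a, ha, hab⟩ : ∃ a ∈ A', H.Adj a b := by simpa [N] using hb
              exact ⟨a, ha, by rintro _ ⟨⟩; exact hab⟩
            · exact ⟨a, ha, by rintro _ ⟨⟩⟩)
  let f : V → V := fun v => Sum.elim id (fun _ => v) (F v)
  let D : Finset V := {v | ∃ b, F v = Sum.inl b}
  have hfD : ∀ v ∈ D, F v = Sum.inl (f v) := by
    intro v hv
    obtain ⟨b, hb⟩ : ∃ b, F v = Sum.inl b := by simpa [D] using hv
    simp [f, hb]
  obtain ⟨B, -, -, hB, hBn⟩ := exists_isCoveredSet_of_injOn (H := H) f D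
    (fun x hx y hy hxy => hF (by rw [hfD x hx, hfD y hy, hxy]))
    (fun v hv => hFr v _ (hfD v hv))
  have hDc : Fintype.card V ≤ D.card + d := by
    have h1 : Dᶜ.card ≤ d := by
      have h2 : Dᶜ.image F ⊆ (Finset.univ : Finset (Fin d)).map ⟨Sum.inr, Sum.inr_injective⟩ := by
        intro z hz
        obtain ⟨v, hv, rfl⟩ := Finset.mem_image.1 hz
        rcases hFv : F v with b | b
        · exact absurd (show v ∈ D by simp [D, hFv]) (Finset.mem_compl.1 hv)
        · simp
      have h3 := Finset.card_le_card h2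
      rwa [Finset.card_image_of_injective _ hF, Finset.card_map, Finset.card_fin] at h3
    have := Finset.card_add_card_compl D
    omega
  refine ⟨fun v => (if v ∈ A then 0 else 1) + (if v ∈ N A then 1 else 0), ?_, ?_, B, hB, ?_⟩
  · intro v
    dsimp only
    split_ifs <;> omega
  · intro x y hxy
    have h1 : x ∈ A → y ∈ N A := fun h => by
      simpa [N] using ⟨x, h, hxy⟩
    have h2 : y ∈ A → x ∈ N A := fun h => by
      simpa [N] using ⟨y, h, hxy.symm⟩
    dsimp only
    split_ifs <;> simp_all
  · refine le_trans ?_ hBn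
    rw [Finset.sum_add_distrib, ← Finset.card_filter, Finset.filter_mem_eq_inter,
      Finset.univ_inter]
    have : ∑ v, (if v ∈ A then 0 else 1) = Fintype.card V - A.card := by
      rw [← Finset.card_compl, show Aᶜ = Finset.univ.filter (· ∉ A) by ext; simp,
        Finset.card_filter]
      exact Finset.sum_congr rfl fun v _ => by split_ifs <;> rfl
    have h4 := Finset.card_le_univ A
    omega

/-! ### Barriers -/

/-- `(U, p)` is a barrier for the graph `H`: every edge of `H` meets `U` or joins two vertices with
the same value of `p`, and no graph with this property has a larger (`2`-)matching than `H`. For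
matchings, `U` is a Tutte set and `p` distinguishes the components of `H - U`; for `2`-matchings,
`U`, the common fibre of `p`, and the singleton fibres of `p` are the vertices of weight `1`, `1/2`
and `0` in an optimal fractional vertex cover. -/
def IsBarrier {V : Type*} (κ : MatchingKind) (H : SimpleGraph V) (U : Set V) (p : V → Set V) :
    Prop :=
  (∀ x y, H.Adj x y → x ∈ U ∨ y ∈ U ∨ p x = p y) ∧
    ∀ T : SimpleGraph V, (∀ x y, T.Adj x y → x ∈ U ∨ y ∈ U ∨ p x = p y) →
      ∀ A, IsCoveredSet κ T A → ∃ B, IsCoveredSet κ H B ∧ A.ncard ≤ B.ncard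

lemma exists_isBarrier_twoMatching {V : Type*} [Finite V] (H : SimpleGraph V) :
    ∃ U p, IsBarrier .twoMatching H U p := by
  classical
  have := Fintype.ofFinite V
  obtain ⟨w, hw2, hw, B, hB, hBw⟩ := exists_weight_le_twoMatching H
  refine ⟨{v | w v = 2}, fun v => if w v = 1 then ∅ else {v}, ?_, ?_⟩
  · intro x y hxy
    by_cases hx : w x = 2
    · exact Or.inl hx
    by_cases hy : w y = 2
    · exact Or.inr (Or.inl hy)
    have h1 := hw x y hxy
    have h2 := hw2 x
    have h3 := hw2 y
    right; right
    simp only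
    rw [if_pos (by omega), if_pos (by omega)]
  · intro T hT A hA
    refine ⟨B, hB, (hA.ncard_le_sum w ?_).trans hBw⟩
    intro x y hxy
    rcases hT x y hxy with h | h | h
    · simp only [Set.mem_ofPred_eq] at h
      omega
    · simp only [Set.mem_ofPred_eq] at h
      omega
    · simp only at h
      split_ifs at h with h1 h2 h2
      · omega
      · exact absurd h.symm (Set.singleton_ne_empty y)
      · exact absurd h (Set.singleton_ne_empty x)
      · exact absurd (Set.singleton_injective h) hxy.ne

/-! ### The barrier of a Tutte set -/

lemma ncard_oddComponents_le_of_reachable {X : Type*} [Finite X] {A B : SimpleGraph X}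
    (hAB : A ≤ B) (hBA : ∀ x y, B.Adj x y → A.Reachable x y) :
    A.oddComponents.ncard ≤ B.oddComponents.ncard := by
  have hreach : ∀ x y, B.Reachable x y → A.Reachable x y := by
    rintro x y ⟨c⟩
    induction c with
    | nil => rfl
    | cons h _ ih => exact (hBA _ _ h).trans ih
  have hinj : Function.Injective (ConnectedComponent.map (Hom.ofLE hAB)) := by
    intro c d
    induction c using ConnectedComponent.ind
    induction d using ConnectedComponent.ind
    intro h
    exact ConnectedComponent.eq.2 (hreach _ _ (ConnectedComponent.eq.1 h))
  refine Set.ncard_le_ncard_of_injOn (ConnectedComponent.map (Hom.ofLE hAB)) ?_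
    hinj.injOn (Set.toFinite _)
  intro c hc
  induction c using ConnectedComponent.ind with
  | h v =>
    have : (ConnectedComponent.map (Hom.ofLE hAB) (A.connectedComponentMk v)).supp =
        (A.connectedComponentMk v).supp := by
      ext x
      simp only [ConnectedComponent.map_mk, ConnectedComponent.mem_supp_iff,
        ConnectedComponent.eq]
      exact ⟨hreach _ _, fun h => h.mono hAB⟩
    simp only [oddComponents, Set.mem_ofPred_eq] at hc ⊢
    rwa [this]

/-- Whether `u` is a Tutte violator depends only on the components of `G - u`. -/
lemma IsTutteViolator.of_reachable {W : Type*} [Finite W] {G G' : SimpleGraph W} {u : Set W}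
    (hG : G.IsTutteViolator u)
    (h : ∀ x y, G'.Adj x y → x ∈ u ∨ y ∈ u ∨ ∃ hx hy,
      ((⊤ : G.Subgraph).deleteVerts u).coe.Reachable ⟨x, hx⟩ ⟨y, hy⟩) :
    G'.IsTutteViolator u := by
  have hJ : (G ⊔ G').IsTutteViolator u := by
    refine lt_of_lt_of_le hG ?_
    refine ncard_oddComponents_le_of_reachable
      (A := ((⊤ : G.Subgraph).deleteVerts u).coe)
      (B := ((⊤ : (G ⊔ G').Subgraph).deleteVerts u).coe) ?_ ?_
    · exact Subgraph.deleteVerts_mono' u le_sup_left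
    · intro x y hxy
      obtain ⟨-, hx, -, hy, hxy⟩ := Subgraph.deleteVerts_adj.1 hxy
      rcases hxy with hxy | hxy
      · exact Adj.reachable (Subgraph.deleteVerts_adj.2 ⟨trivial, hx, trivial, hy, hxy⟩)
      · rcases h _ _ hxy with h | h | ⟨_, _, h⟩
        · exact absurd h hx
        · exact absurd h hy
        · exact h
  exact hJ.mono le_sup_right

/-- The graph `H` with `t` further vertices, each joined to all other vertices. -/
def SimpleGraph.addUniversal {V : Type*} (H : SimpleGraph V) (t : ℕ) :
    SimpleGraph (V ⊕ Fin t) where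
  Adj a b := a ≠ b ∧ ∀ x y, a = Sum.inl x → b = Sum.inl y → H.Adj x y
  symm := ⟨fun _ _ h => ⟨h.1.symm, fun x y hx hy => (h.2 y x hy hx).symm⟩⟩
  loopless := ⟨fun _ h => h.1 rfl⟩

lemma IsCoveredSet.even_ncard {V : Type*} [Finite V] {H : SimpleGraph V} {A : Set V}
    (hA : IsCoveredSet .matching H A) : Even A.ncard := by
  obtain ⟨M, hM, rfl⟩ := hA
  have := Fintype.ofFinite M.verts
  rw [Set.ncard_eq_toFinset_card']
  exact hM.even_card

/-- A perfect matching after adding `t` universal vertices leaves at most `t` vertices of `H`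
without a partner in `H`. -/
lemma exists_isCoveredSet_of_addUniversal {V : Type*} [Finite V] {H : SimpleGraph V} {t : ℕ}
    {M : (H.addUniversal t).Subgraph} (hM : M.IsPerfectMatching) :
    ∃ A, IsCoveredSet .matching H A ∧ Nat.card V ≤ A.ncard + t := by
  let A : Set V := {v | ∃ w, M.Adj (Sum.inl v) (Sum.inl w)}
  refine ⟨A, ⟨⟨A, fun v w => M.Adj (Sum.inl v) (Sum.inl w), ?_, ?_, ?_⟩, ?_, rfl⟩, ?_⟩
  · intro v w h
    exact h.adj_sub.2 v w rfl rfl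
  · intro v w h
    exact ⟨w, h⟩
  · exact ⟨fun v w h => h.symm⟩
  · rintro v ⟨w, hw⟩
    exact ⟨w, hw, fun w' hw' => Sum.inl_injective (hM.1.eq_of_adj_left hw' hw)⟩
  · have h1 : ∀ v : (Aᶜ : Set V), ∃ i : Fin t, M.Adj (Sum.inl v.1) (Sum.inr i) := by
      rintro ⟨v, hv⟩
      obtain ⟨w, hw, -⟩ := hM.1 (hM.2 (Sum.inl v))
      rcases w with w | i
      · exact absurd ⟨w, hw⟩ hv
      · exact ⟨i, hw⟩
    choose g hg using h1
    have hgi : Function.Injective g := fun v w h =>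
      Subtype.ext (Sum.inl_injective (hM.1.eq_of_adj_right (hg v) (h ▸ hg w)))
    have h2 := Nat.card_le_card_of_injective g hgi
    rw [Nat.card_coe_set_eq, Nat.card_fin] at h2
    have := Set.ncard_add_ncard_compl A
    omega

/-- Conversely, a matching that misses at most `t` vertices extends to a perfect matching after
adding `t` universal vertices, parity permitting. -/
lemma IsCoveredSet.exists_isPerfectMatching_addUniversal {V : Type*} [Finite V]
    {H : SimpleGraph V} {t : ℕ} {A : Set V} (hA : IsCoveredSet .matching H A)
    (hAt : Nat.card V ≤ A.ncard + t) (heven : Even (Nat.card V + t)) :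
    ∃ M : (H.addUniversal t).Subgraph, M.IsPerfectMatching := by
  have hA2 := hA.even_ncard
  obtain ⟨M, hM, hMA⟩ := hA.map (H' := H.addUniversal t) Sum.inl_injective (by
    intro x _ y _ hxy
    refine ⟨fun h => hxy.ne (Sum.inl_injective h), ?_⟩
    rintro _ _ ⟨⟩ ⟨⟩
    exact hxy)
  -- Every uncovered vertex of `H` is matched with a new vertex, and the new vertices that are left
  -- over form a clique of even order.
  have hc : (Sum.inl '' Aᶜ : Set (V ⊕ Fin t)).ncard ≤
      (Set.range (Sum.inr : Fin t → V ⊕ Fin t)).ncard := by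
    rw [Set.ncard_image_of_injective _ Sum.inl_injective, ← Set.image_univ,
      Set.ncard_image_of_injective _ Sum.inr_injective, Set.ncard_univ, Nat.card_fin]
    have := Set.ncard_add_ncard_compl A
    omega
  obtain ⟨t', ht', hcard⟩ := Set.exists_subset_card_eq hc
  have hdisj : Disjoint (Sum.inl '' Aᶜ : Set (V ⊕ Fin t)) t' := by
    rw [Set.disjoint_left]
    rintro _ ⟨v, -, rfl⟩ h
    obtain ⟨i, hi⟩ := ht' h
    cases hi
  obtain ⟨e⟩ : Nonempty ((Sum.inl '' Aᶜ : Set (V ⊕ Fin t)) ≃ t') := by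
    apply Finite.card_eq.1 ?_
    rw [Nat.card_coe_set_eq, Nat.card_coe_set_eq, hcard]
  obtain ⟨M1, hM1v, hM1⟩ := Subgraph.IsMatching.exists_of_disjoint_sets_of_equiv
    (G := H.addUniversal t) hdisj e (fun v =>
      ⟨fun h => Set.disjoint_left.1 hdisj v.2 (h ▸ (e v).2), by
      intro x y _ hy
      obtain ⟨i, hi⟩ := ht' (e v).2
      rw [hy] at hi
      cases hi⟩)
  have hMM1 : (M ⊔ M1).IsMatching := hM.sup hM1 (by
    rw [hM.support_eq_verts, hM1.support_eq_verts, hMA, hM1v, Set.disjoint_union_right]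
    constructor
    · rw [Set.disjoint_image_iff Sum.inl_injective]
      exact disjoint_compl_right
    · rw [Set.disjoint_left]
      rintro _ ⟨v, -, rfl⟩ h
      obtain ⟨i, hi⟩ := ht' h
      cases hi)
  set R := (M ⊔ M1).vertsᶜ with hR
  have hRr : R ⊆ Set.range Sum.inr := by
    rintro (v | i) h
    · exfalso
      apply h
      rw [Subgraph.verts_sup, hMA, hM1v]
      by_cases hv : v ∈ A
      · exact Or.inl ⟨v, hv, rfl⟩
      · exact Or.inr (Or.inl ⟨v, hv, rfl⟩)
    · exact ⟨i, rfl⟩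
  have hclique : (H.addUniversal t).IsClique R := by
    intro a ha b hb hab
    refine ⟨hab, ?_⟩
    rintro x y rfl rfl
    obtain ⟨i, hi⟩ := hRr ha
    cases hi
  have hReven : Even R.ncard := by
    have h1 : Even (M ⊔ M1).verts.ncard := IsCoveredSet.even_ncard ⟨_, hMM1, rfl⟩
    have h2 := Set.ncard_add_ncard_compl (M ⊔ M1).verts
    rw [Nat.card_sum, Nat.card_fin, ← hR] at h2
    rw [← h2, Nat.even_add] at heven
    exact heven.1 h1
  obtain ⟨M2, hM2v, hM2⟩ := (hclique.even_iff_exists_isMatching (Set.toFinite _)).1 hReven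
  refine ⟨M ⊔ M1 ⊔ M2, hMM1.sup hM2 ?_, ?_⟩
  · rw [hMM1.support_eq_verts, hM2.support_eq_verts, hM2v]
    exact disjoint_compl_right
  · rw [Subgraph.isSpanning_iff, Subgraph.verts_sup, hM2v]
    exact Set.union_compl_self _

/-- If a maximum matching covers `m` vertices, then `H` with `t = |V| - m - 2` universal vertices
has no perfect matching. Its Tutte violator `u` stays one when all edges that meet `u` or lie inside
a component of the graph without `u` are added. -/
lemma exists_isBarrier_matching {V : Type*} [Finite V] (H : SimpleGraph V) :
    ∃ U p, IsBarrier .matching H U p := by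
  obtain ⟨B, hB, hmax⟩ := Set.exists_max_image {A | IsCoveredSet .matching H A} Set.ncard
    (Set.toFinite _) ⟨∅, isCoveredSet_empty .matching H⟩
  have hBe := IsCoveredSet.even_ncard hB
  by_cases hlt : Nat.card V < B.ncard + 2
  -- By parity, no graph on `V` has a matching that covers more than `B.ncard` vertices.
  · refine ⟨Set.univ, fun _ => ∅, fun x y _ => Or.inl trivial, fun T _ A hA => ⟨B, hB, ?_⟩⟩
    have h1 := hA.even_ncard
    have h2 := Set.ncard_le_card A
    rw [Nat.even_iff] at h1 hBe
    omega
  · obtain ⟨t, ht⟩ := Nat.exists_eq_add_of_le (not_lt.1 hlt)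
    have hno : ¬ ∃ M : (H.addUniversal t).Subgraph, M.IsPerfectMatching := by
      rintro ⟨M, hM⟩
      obtain ⟨A, hA, hAt⟩ := exists_isCoveredSet_of_addUniversal hM
      have := hmax A hA
      omega
    rw [SimpleGraph.tutte] at hno
    push Not at hno
    obtain ⟨u, hu⟩ := hno
    set D := ((⊤ : (H.addUniversal t).Subgraph).deleteVerts u).coe with hD
    have hmem : ∀ a, a ∉ u → a ∈ ((⊤ : (H.addUniversal t).Subgraph).deleteVerts u).verts :=
      fun a ha => ⟨trivial, ha⟩
    let p : V → Set V := fun x => {z | ∃ hx hz, D.Reachable ⟨Sum.inl x, hx⟩ ⟨Sum.inl z, hz⟩}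
    have hedge : ∀ a b, (H.addUniversal t).Adj a b → a ∈ u ∨ b ∈ u ∨
        ∃ ha hb, D.Reachable ⟨a, ha⟩ ⟨b, hb⟩ := by
      intro a b hab
      by_cases ha : a ∈ u
      · exact Or.inl ha
      by_cases hb : b ∈ u
      · exact Or.inr (Or.inl hb)
      refine Or.inr (Or.inr ⟨hmem a ha, hmem b hb, Adj.reachable ?_⟩)
      exact Subgraph.deleteVerts_adj.2 ⟨trivial, ha, trivial, hb, hab⟩
    refine ⟨{x | Sum.inl x ∈ u}, p, ?_, ?_⟩
    · intro x y hxy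
      rcases hedge (Sum.inl x) (Sum.inl y) ⟨fun h => hxy.ne (Sum.inl_injective h), by
        rintro _ _ ⟨⟩ ⟨⟩
        exact hxy⟩ with h | h | ⟨hx, hy, h⟩
      · exact Or.inl h
      · exact Or.inr (Or.inl h)
      · right; right
        ext z
        exact ⟨fun ⟨_, hz, h'⟩ => ⟨hy, hz, h.symm.trans h'⟩,
          fun ⟨_, hz, h'⟩ => ⟨hx, hz, h.trans h'⟩⟩
    · intro T hT A hA
      refine ⟨B, hB, ?_⟩
      by_contra! hAB
      have hAe := hA.even_ncard
      obtain ⟨M, hM⟩ := hA.exists_isPerfectMatching_addUniversal (t := t)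
        (by rw [Nat.even_iff] at hAe hBe; omega) (by rw [Nat.even_iff] at hBe ⊢; omega)
      refine SimpleGraph.tutte.1 ⟨M, hM⟩ u (IsTutteViolator.of_reachable hu ?_)
      rintro (x | i) (y | j) hab
      · rcases hT x y (hab.2 x y rfl rfl) with h | h | h
        · exact Or.inl h
        · exact Or.inr (Or.inl h)
        · by_cases hx : Sum.inl x ∈ u
          · exact Or.inl hx
          have : x ∈ p x := ⟨hmem _ hx, hmem _ hx, Reachable.refl _⟩
          rw [h] at this
          obtain ⟨hy, hx, h'⟩ := this
          exact Or.inr (Or.inr ⟨hx, hy, h'.symm⟩)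
      · exact hedge _ _ ⟨hab.1, by rintro _ _ _ ⟨⟩⟩
      · exact hedge _ _ ⟨hab.1, by rintro _ _ ⟨⟩⟩
      · exact hedge _ _ ⟨hab.1, by rintro _ _ ⟨⟩⟩

lemma exists_isBarrier {V : Type*} [Finite V] (κ : MatchingKind) (H : SimpleGraph V) :
    ∃ U p, IsBarrier κ H U p := by
  cases κ with
  | matching => exact exists_isBarrier_matching H
  | twoMatching => exact exists_isBarrier_twoMatching H

/-! ### A set-pair inequality -/

/-- There is a random pair of sets `P`, `Q` (uniform over a finite space `Ω`) such that no element
of `P` is related to an element of `Q`, while every unrelated pair `x ≠ y` is in `P × Q` with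
probability at least `1 / c`. -/
def IsRandomlySeparable {V : Type*} (R : V → V → Prop) (c : ℕ) : Prop :=
  ∃ (Ω : Type) (_ : Finite Ω) (_ : Nonempty Ω) (P Q : Ω → V → Prop),
    (∀ ω x y, P ω x → Q ω y → ¬ R x y) ∧
      ∀ x y, x ≠ y → ¬ R x y → Nat.card Ω ≤ c * {ω | P ω x ∧ Q ω y}.ncard

/-- Tverberg's probabilistic proof of a set-pair inequality: the events that a pair of `M` is
separated by all relations at once are pairwise disjoint, and none is very unlikely. -/
lemma card_le_prod_of_isRandomlySeparable {V ι : Type*} [Fintype ι] {R : ι → V → V → Prop}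
    {c : ι → ℕ} (hR : ∀ i, IsRandomlySeparable (R i) (c i)) (M : Finset (V × V))
    (hM : ∀ e ∈ M, e.1 ≠ e.2 ∧ ∀ i, ¬ R i e.1 e.2)
    (hcross : ∀ e ∈ M, ∀ e' ∈ M, e ≠ e' → ∃ i, R i e.1 e'.2) : M.card ≤ ∏ i, c i := by
  classical
  choose Ω hfin hne P Q hPQ hc using hR
  have : ∀ i, Fintype (Ω i) := fun i => Fintype.ofFinite _
  let E : V × V → Finset (∀ i, Ω i) := fun e =>
    Fintype.piFinset fun i => {ω | P i ω e.1 ∧ Q i ω e.2}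
  have hdis : (M : Set (V × V)).PairwiseDisjoint E := by
    intro e he e' he' hee
    rw [Function.onFun, Finset.disjoint_left]
    intro ω hω hω'
    obtain ⟨i, hi⟩ := hcross e he e' he' hee
    have h1 := Fintype.mem_piFinset.1 hω i
    have h2 := Fintype.mem_piFinset.1 hω' i
    simp only [Finset.mem_filter, Finset.mem_univ, true_and] at h1 h2
    exact hPQ i _ _ _ h1.1 h2.2 hi
  have hE : ∀ e ∈ M, Fintype.card (∀ i, Ω i) ≤ (∏ i, c i) * (E e).card := by
    intro e he
    rw [Fintype.card_piFinset, Fintype.card_pi, ← Finset.prod_mul_distrib]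
    refine Finset.prod_le_prod' fun i _ => ?_
    have := hc i e.1 e.2 (hM e he).1 ((hM e he).2 i)
    rwa [Nat.card_eq_fintype_card, Set.ncard_eq_toFinset_card', Set.toFinset_ofPred] at this
  have hpos : 0 < Fintype.card (∀ i, Ω i) := Fintype.card_pos
  refine Nat.le_of_mul_le_mul_right ?_ hpos
  calc M.card * Fintype.card (∀ i, Ω i) = ∑ _e ∈ M, Fintype.card (∀ i, Ω i) := by
        rw [Finset.sum_const, smul_eq_mul]
    _ ≤ ∑ e ∈ M, (∏ i, c i) * (E e).card := Finset.sum_le_sum hE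
    _ = (∏ i, c i) * (M.biUnion E).card := by
        rw [← Finset.mul_sum, Finset.card_biUnion hdis]
    _ ≤ _ := Nat.mul_le_mul_left _ (Finset.card_le_univ _)

/-- An event `E` that every outcome can be moved into, losing only the information `φ`, is not too
unlikely. -/
lemma card_le_mul_ncard {Ω T : Type*} [Finite Ω] [Finite T] {E : Set Ω} (φ : Ω → T) (ψ : Ω → Ω)
    (hψ : ∀ ω, ψ ω ∈ E) (hinj : ∀ ω ω', φ ω = φ ω' → ψ ω = ψ ω' → ω = ω') :
    Nat.card Ω ≤ Nat.card T * E.ncard := by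
  rw [← Nat.card_coe_set_eq, ← Nat.card_prod]
  refine Nat.card_le_card_of_injective (fun ω => (φ ω, (⟨ψ ω, hψ ω⟩ : E))) ?_
  intro ω ω' h
  simp only [Prod.mk.injEq, Subtype.mk.injEq] at h
  exact hinj ω ω' h.1 h.2

lemma eq_of_update_eq {X Y : Type*} [DecidableEq X] {h h' : X → Y} {a : X} {s : Y}
    (ha : h a = h' a) (he : Function.update h a s = Function.update h' a s) : h = h' := by
  have := congrArg (fun g => Function.update g a (h a)) he
  simp only [Function.update_idem, Function.update_eq_self] at this
  rw [this, ha, Function.update_eq_self]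

lemma eq_of_update_update_eq {X Y : Type*} [DecidableEq X] {h h' : X → Y} {a b : X} {s t : Y}
    (ha : h a = h' a) (hb : h b = h' b)
    (he : Function.update (Function.update h a s) b t =
      Function.update (Function.update h' a s) b t) : h = h' := by
  by_cases hab : b = a
  · subst hab
    rw [Function.update_idem, Function.update_idem] at he
    exact eq_of_update_eq ha he
  · refine eq_of_update_eq ha (eq_of_update_eq ?_ he)
    rw [Function.update_of_ne hab, Function.update_of_ne hab, hb]

/-! ### Saturating one colour -/

/-- The adjacency of a saturated colour: both vertices are in the same part `c x` and, in the parts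
of `B`, on different sides, whereas in other parts they meet `U` or have the same value of `p`. -/
def SaturatedAdj {V γ : Type*} (c : V → γ) (B : Set γ) (side : V → Bool) (U : Set V)
    (p : V → Set V) (x y : V) : Prop :=
  x ≠ y ∧ c x = c y ∧ (c x ∈ B ∧ side x ≠ side y ∨ c x ∉ B ∧ (x ∈ U ∨ y ∈ U ∨ p x = p y))

/-- With probability `1/2`, distribute whole parts between `P` and `Q`, each by a coin. Otherwise
choose one side in each part of `B`, for both `P` and `Q`, and distribute the fibres of `p` outside
`U` between `P` and `Q` in the other parts. -/
lemma isRandomlySeparable_saturatedAdj {V γ : Type} [Finite V] [Finite γ] (c : V → γ) (B : Set γ)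
    (side : V → Bool) (U : Set V) (p : V → Set V) :
    IsRandomlySeparable (SaturatedAdj c B side U p) 8 := by
  classical
  let S : Bool → Bool × (γ → Bool) × (Set V → Bool) → V → Prop := fun r ω x =>
    (ω.1 = true ∧ ω.2.1 (c x) = r) ∨
      (ω.1 = false ∧ (c x ∈ B ∧ side x = ω.2.1 (c x) ∨ c x ∉ B ∧ x ∉ U ∧ ω.2.2 (p x) = r))
  have h8 : 8 = Nat.card (Bool × Bool × Bool) := by simp
  refine ⟨Bool × (γ → Bool) × (Set V → Bool), inferInstance, inferInstance,
    S true, S false, ?_, ?_⟩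
  · rintro ⟨m, h, g⟩ x y hx hy ⟨-, hxy, hR⟩
    simp only [S] at hx hy
    rw [← hxy] at hy
    rcases hx with ⟨rfl, hx⟩ | ⟨rfl, ⟨hB, hx⟩ | ⟨hB, hU, hx⟩⟩
    · simp [hx] at hy
    · rcases hR with ⟨-, hR⟩ | ⟨hB', -⟩
      · simp only [Bool.false_eq_true, false_and, hB, true_and, not_true_eq_false, or_false,
          false_or] at hy
        exact hR (hx.trans hy.symm)
      · exact hB' hB
    · simp only [Bool.false_eq_true, false_and, hB, true_and, not_false_eq_true, false_or] at hy
      rcases hR with ⟨hB', -⟩ | ⟨-, hR | hR | hR⟩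
      · exact hB hB'
      · exact hU hR
      · exact hy.1 hR
      · rw [hR, hy.2] at hx
        exact absurd hx (by decide)
  · intro x y hne hR
    rw [h8]
    by_cases hc : c x = c y
    · by_cases hB : c x ∈ B
      · have hs : side x = side y := by
          by_contra hs
          exact hR ⟨hne, hc, Or.inl ⟨hB, hs⟩⟩
        refine card_le_mul_ncard (fun ω => (ω.1, ω.2.1 (c x), false))
          (fun ω => (false, Function.update ω.2.1 (c x) (side x), ω.2.2)) ?_ ?_
        · rintro ⟨m, h, g⟩
          refine ⟨Or.inr ⟨rfl, Or.inl ⟨hB, by simp⟩⟩, Or.inr ⟨rfl, Or.inl ⟨hc ▸ hB, ?_⟩⟩⟩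
          simp [← hc, hs]
        · rintro ⟨m, h, g⟩ ⟨m', h', g'⟩ h1 h2
          simp only [Prod.mk.injEq] at h1 h2
          simp only [Prod.mk.injEq]
          exact ⟨h1.1, eq_of_update_eq h1.2.1 h2.2.1, h2.2.2⟩
      · have hs : x ∉ U ∧ y ∉ U ∧ p x ≠ p y := by
          refine ⟨fun h => ?_, fun h => ?_, fun h => ?_⟩ <;>
          exact hR ⟨hne, hc, Or.inr ⟨hB, by simp [h]⟩⟩
        refine card_le_mul_ncard (fun ω => (ω.1, ω.2.2 (p x), ω.2.2 (p y)))
          (fun ω => (false, ω.2.1,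
            Function.update (Function.update ω.2.2 (p x) true) (p y) false)) ?_ ?_
        · rintro ⟨m, h, g⟩
          refine ⟨Or.inr ⟨rfl, Or.inr ⟨hB, hs.1, ?_⟩⟩, Or.inr ⟨rfl, Or.inr ⟨hc ▸ hB, hs.2.1, ?_⟩⟩⟩
          · simp [Function.update_of_ne hs.2.2]
          · simp
        · rintro ⟨m, h, g⟩ ⟨m', h', g'⟩ h1 h2
          simp only [Prod.mk.injEq] at h1 h2
          simp only [Prod.mk.injEq]
          exact ⟨h1.1, h2.2.1, eq_of_update_update_eq h1.2.1 h1.2.2 h2.2.2⟩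
    · refine card_le_mul_ncard (fun ω => (ω.1, ω.2.1 (c x), ω.2.1 (c y)))
        (fun ω => (true, Function.update (Function.update ω.2.1 (c x) true) (c y) false,
          ω.2.2)) ?_ ?_
      · rintro ⟨m, h, g⟩
        refine ⟨Or.inl ⟨rfl, ?_⟩, Or.inl ⟨rfl, ?_⟩⟩
        · simp [Function.update_of_ne hc]
        · simp
      · rintro ⟨m, h, g⟩ ⟨m', h', g'⟩ h1 h2
        simp only [Prod.mk.injEq] at h1 h2
        simp only [Prod.mk.injEq]
        exact ⟨h1.1, eq_of_update_update_eq h1.2.1 h1.2.2 h2.2.1, h2.2.2⟩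

/-- Every graph `H` is contained in a graph with separable non-adjacency and no larger connected
(`2`-)matchings, either in arbitrary components (if `b` is false) or in non-bipartite ones (if `b`
is true). The components of `H` are saturated one by one along barriers; for true `b`, bipartite
components become complete bipartite instead. -/
lemma exists_saturation {V : Type} [Finite V] (κ : MatchingKind) (H : SimpleGraph V) (b : Prop) :
    ∃ H' : SimpleGraph V, H ≤ H' ∧ IsRandomlySeparable H'.Adj 8 ∧ ∀ x : ℝ,
      (¬ b → HasConnectedMatching κ H' x → HasConnectedMatching κ H x) ∧
      (b → HasNonbipartiteConnectedMatching κ H' x →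
        HasNonbipartiteConnectedMatching κ H x) := by
  classical
  let c : V → H.ConnectedComponent := H.connectedComponentMk
  have hcadj : ∀ {x y}, H.Adj x y → c x = c y := fun h => ConnectedComponent.eq.2 h.reachable
  let HK : H.ConnectedComponent → SimpleGraph V := fun K =>
    { Adj := fun x y => H.Adj x y ∧ c x = K
      symm := ⟨fun x y h => ⟨h.1.symm, (hcadj h.1).symm.trans h.2⟩⟩
      loopless := ⟨fun x h => H.irrefl h.1⟩ }
  choose U p hbar using fun K => exists_isBarrier κ (HK K)
  have hside : ∀ K : H.ConnectedComponent, K.toSimpleGraph.IsBipartite →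
      ∃ side : V → Bool, ∀ x y, c x = K → H.Adj x y → side x ≠ side y := by
    rintro K ⟨C⟩
    refine ⟨fun v => if h : v ∈ K.supp then decide (C ⟨v, h⟩ = 0) else false, ?_⟩
    intro x y hx hxy
    have hy : y ∈ K.supp := (hcadj hxy).symm.trans hx
    have hx' : x ∈ K.supp := hx
    have h1 : C ⟨x, hx'⟩ ≠ C ⟨y, hy⟩ := C.valid hxy
    simp only [hx', hy, dif_pos]
    intro h2
    rw [decide_eq_decide] at h2
    omega
  choose! side hside using hside
  let B : Set H.ConnectedComponent := {K | b ∧ K.toSimpleGraph.IsBipartite}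
  let H' : SimpleGraph V :=
    { Adj := SaturatedAdj c B (fun x => side (c x) x) {x | x ∈ U (c x)} (fun x => p (c x) x)
      symm := ⟨by
        rintro x y ⟨h1, h2, h3⟩
        refine ⟨h1.symm, h2.symm, ?_⟩
        rw [← h2]
        rcases h3 with ⟨h3, h4⟩ | ⟨h3, h4 | h4 | h4⟩
        · exact Or.inl ⟨h3, h4.symm⟩
        · exact Or.inr ⟨h3, Or.inr (Or.inl h4)⟩
        · exact Or.inr ⟨h3, Or.inl h4⟩
        · exact Or.inr ⟨h3, Or.inr (Or.inr h4.symm)⟩⟩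
      loopless := ⟨fun x h => h.1 rfl⟩ }
  have hle : H ≤ H' := by
    intro x y hxy
    refine ⟨hxy.ne, hcadj hxy, ?_⟩
    by_cases hB : c x ∈ B
    · refine Or.inl ⟨hB, ?_⟩
      dsimp only
      rw [← hcadj hxy]
      exact hside _ hB.2 x y rfl hxy
    · refine Or.inr ⟨hB, ?_⟩
      have := (hbar (c x)).1 x y ⟨hxy, rfl⟩
      simp only [Set.mem_ofPred_eq]
      rwa [← hcadj hxy]
  have hreach : ∀ x y, H'.Reachable x y → c x = c y := by
    rintro x y ⟨w⟩
    induction w with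
    | nil => rfl
    | cons h _ ih => exact h.2.1.trans ih
  -- A component of `H'` lies in a component `K` of `H`, where the barrier of `K` applies.
  have key : ∀ K' : H'.ConnectedComponent, ∃ K : H.ConnectedComponent, K'.supp ⊆ K.supp ∧
      (K ∉ B → ∀ A ⊆ K'.supp, IsCoveredSet κ H' A →
        ∃ A' ⊆ K.supp, IsCoveredSet κ H A' ∧ A.ncard ≤ A'.ncard) ∧
      (K ∈ B → K'.toSimpleGraph.IsBipartite) := by
    intro K'
    induction K' using ConnectedComponent.ind with
    | h v =>
    have hsub : (H'.connectedComponentMk v).supp ⊆ (c v).supp := fun x hx =>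
      hreach _ _ (ConnectedComponent.eq.1 hx)
    refine ⟨c v, hsub, ?_, ?_⟩
    · intro hB A hA hcov
      let T : SimpleGraph V :=
        { Adj := fun x y => H'.Adj x y ∧ c x = c v
          symm := ⟨fun x y h => ⟨h.1.symm, h.1.2.1.symm.trans h.2⟩⟩
          loopless := ⟨fun x h => H'.irrefl h.1⟩ }
      have hT : IsCoveredSet κ T A := hcov.mono fun x hx y _ hxy => ⟨hxy, hsub (hA hx)⟩
      obtain ⟨A', hA', hn⟩ := (hbar (c v)).2 T (by
        rintro x y ⟨⟨-, hxy, h⟩, hx⟩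
        simp only [Set.mem_ofPred_eq, ← hxy, hx, hB, false_and, not_false_eq_true, true_and,
          false_or] at h
        exact h) A hT
      refine ⟨A', ?_, hA'.mono fun x _ y _ hxy => hxy.1, hn⟩
      intro x hx
      obtain ⟨y, hy⟩ := hA'.exists_adj hx
      exact hy.2
    · intro hB
      refine ⟨Coloring.mk (fun x => if side (c v) x then 0 else 1) ?_⟩
      rintro ⟨x, hx⟩ ⟨y, hy⟩ hxy
      obtain ⟨-, h1, h2⟩ : H'.Adj x y := hxy
      have hxv : c x = c v := hsub hx
      simp only [← h1, hxv, hB, not_true_eq_false, false_and, or_false, true_and] at h2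
      dsimp only
      split_ifs <;> simp_all
  refine ⟨H', hle, isRandomlySeparable_saturatedAdj _ _ _ _ _, fun x => ⟨?_, ?_⟩⟩
  · rintro hb ⟨K', A, hA, hcov, hx⟩
    obtain ⟨K, -, h, -⟩ := key K'
    obtain ⟨A', hA', hcov', hn⟩ := h (fun h => hb h.1) A hA hcov
    exact ⟨K, A', hA', hcov', hx.trans (by exact_mod_cast hn)⟩
  · rintro hb ⟨K', A, hK', hA, hcov, hx⟩
    obtain ⟨K, -, h, h'⟩ := key K'
    have hKB : K ∉ B := fun hK => hK' (h' hK)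
    obtain ⟨A', hA', hcov', hn⟩ := h hKB A hA hcov
    exact ⟨K, A', fun h => hKB ⟨hb, h⟩, hA', hcov', hx.trans (by exact_mod_cast hn)⟩

/-! ### Connected matchings under injective homomorphisms -/

lemma HasConnectedMatching.map {V W : Type*} {κ : MatchingKind} {H : SimpleGraph V}
    {H' : SimpleGraph W} {x : ℝ} (h : HasConnectedMatching κ H x) (f : H →g H')
    (hf : Function.Injective f) : HasConnectedMatching κ H' x := by
  obtain ⟨K, S, hS, hcov, hx⟩ := h
  refine ⟨K.map f, f '' S, ?_, hcov.map hf fun _ _ _ _ h => f.map_adj h, ?_⟩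
  · rintro _ ⟨v, hv, rfl⟩
    have := hS hv
    rw [ConnectedComponent.mem_supp_iff] at this ⊢
    rw [← this, ConnectedComponent.map_mk]
  · rwa [Set.ncard_image_of_injective _ hf]

lemma HasNonbipartiteConnectedMatching.map {V W : Type*} {κ : MatchingKind} {H : SimpleGraph V}
    {H' : SimpleGraph W} {x : ℝ} (h : HasNonbipartiteConnectedMatching κ H x) (f : H →g H')
    (hf : Function.Injective f) : HasNonbipartiteConnectedMatching κ H' x := by
  obtain ⟨K, S, hK, hS, hcov, hx⟩ := h
  have hsupp : ∀ v ∈ K.supp, f v ∈ (K.map f).supp := by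
    intro v hv
    rw [ConnectedComponent.mem_supp_iff] at hv ⊢
    rw [← hv, ConnectedComponent.map_mk]
  refine ⟨K.map f, f '' S, fun hbip => hK ?_, ?_, hcov.map hf fun _ _ _ _ h => f.map_adj h, ?_⟩
  · let g : K.toSimpleGraph →g (K.map f).toSimpleGraph :=
      ⟨fun v => ⟨f v.1, hsupp v.1 v.2⟩, fun {a b} h => f.map_adj (v := a.1) (w := b.1) h⟩
    exact Colorable.of_hom g hbip
  · rintro _ ⟨v, hv, rfl⟩
    exact hsupp v (hS hv)
  · rwa [Set.ncard_image_of_injective _ hf]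

/-! ### Hitting the bad pairs -/

/-- Take a maximal family of edges `xᵢyᵢ` of `J` such that all cross pairs `xᵢyⱼ` are distinct
non-edges. The set-pair inequality bounds its size, and by maximality every edge of `J` has an end
that is a `J`-neighbour of some `xᵢ` or `yᵢ`. -/
lemma exists_finset_forall_adj_exists_adj {V ι : Type*} [Finite V] [Fintype ι]
    (J : SimpleGraph V) {R : ι → V → V → Prop} {c : ι → ℕ}
    (hR : ∀ i, IsRandomlySeparable (R i) (c i))
    (hJ : ∀ x y, J.Adj x y ↔ x ≠ y ∧ ∀ i, ¬ R i x y) :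
    ∃ D : Finset V, D.card ≤ 2 * ∏ i, c i ∧
      ∀ x y, J.Adj x y → ∃ u ∈ D, J.Adj u x ∨ J.Adj u y := by
  classical
  have := Fintype.ofFinite V
  let 𝓜 : Finset (Finset (V × V)) := {M | (∀ e ∈ M, J.Adj e.1 e.2) ∧
    ∀ e ∈ M, ∀ e' ∈ M, e ≠ e' → e.1 ≠ e'.2 ∧ ¬ J.Adj e.1 e'.2}
  obtain ⟨M, hM, hmax⟩ := Finset.exists_max_image 𝓜 Finset.card ⟨∅, by simp [𝓜]⟩
  simp only [𝓜, Finset.mem_filter, Finset.mem_univ, true_and] at hM hmax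
  refine ⟨M.image Prod.fst ∪ M.image Prod.snd, ?_, ?_⟩
  · have h1 := card_le_prod_of_isRandomlySeparable hR M (fun e he => (hJ _ _).1 (hM.1 e he)) (by
      intro e he e' he' hne
      obtain ⟨h1, h2⟩ := hM.2 e he e' he' hne
      by_contra! h3
      exact h2 ((hJ _ _).2 ⟨h1, h3⟩))
    have h2 := Finset.card_union_le (M.image Prod.fst) (M.image Prod.snd)
    have h3 : (M.image Prod.fst).card ≤ M.card := Finset.card_image_le
    have h4 : (M.image Prod.snd).card ≤ M.card := Finset.card_image_le
    omega
  · intro x y hxy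
    by_contra! hno
    have hfst : ∀ e ∈ M, ¬ J.Adj e.1 x ∧ ¬ J.Adj e.1 y := fun e he =>
      hno e.1 (Finset.mem_union_left _ (Finset.mem_image_of_mem _ he))
    have hsnd : ∀ e ∈ M, ¬ J.Adj e.2 x ∧ ¬ J.Adj e.2 y := fun e he =>
      hno e.2 (Finset.mem_union_right _ (Finset.mem_image_of_mem _ he))
    have hnot : (x, y) ∉ M := fun h => (hfst _ h).2 hxy
    have h1 := hmax (insert (x, y) M) ⟨?_, ?_⟩
    · rw [Finset.card_insert_of_notMem hnot] at h1
      omega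
    · intro e he
      rcases Finset.mem_insert.1 he with rfl | he
      · exact hxy
      · exact hM.1 e he
    · intro e he e' he' hne
      rcases Finset.mem_insert.1 he with rfl | he <;>
      rcases Finset.mem_insert.1 he' with rfl | he'
      · exact absurd rfl hne
      · exact ⟨fun h => (hsnd e' he').2 (by rw [← h]; exact hxy),
          fun h => (hsnd e' he').1 h.symm⟩
      · exact ⟨fun h => (hfst e he).1 (by rw [h]; exact hxy.symm), (hfst e he).2⟩
      · exact hM.2 e he e' he' hne

lemma isRandomlySeparable_not_comp {V : Type*} {s : ℕ} (hs : 0 < s) (π : V → Fin s)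
    (A : Fin s → Fin s → Prop) : IsRandomlySeparable (fun x y => ¬ A (π x) (π y)) (s ^ 2) := by
  have : Nonempty (Fin s) := ⟨⟨0, hs⟩⟩
  refine ⟨Fin s × Fin s, inferInstance, inferInstance, fun ω x => A ω.1 ω.2 ∧ π x = ω.1,
    fun ω y => π y = ω.2, ?_, ?_⟩
  · rintro ω x y ⟨h, hx⟩ hy hn
    rw [hx, hy] at hn
    exact hn h
  · intro x y _ h
    have h1 : 1 ≤ {ω : Fin s × Fin s | (A ω.1 ω.2 ∧ π x = ω.1) ∧ π y = ω.2}.ncard :=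
      (Set.ncard_pos (Set.toFinite _)).2 ⟨(π x, π y), ⟨not_not.1 h, rfl⟩, rfl⟩
    rw [Nat.card_prod, Nat.card_fin, ← sq]
    exact Nat.le_mul_of_pos_right _ h1

/-! ### Assembling the new colouring -/

lemma exists_embedding_avoiding {s : ℕ} {m M : Fin s → ℕ} (Z : Set (Σ i, Fin (M i)))
    (h : ∀ i, m i + Z.ncard ≤ M i) :
    ∃ f : (Σ i, Fin (m i)) ↪ (Σ i, Fin (M i)), (∀ x, (f x).1 = x.1) ∧ ∀ x, f x ∉ Z := by
  classical
  have hcard : ∀ i, Fintype.card (Fin (m i)) ≤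
      Fintype.card {j : Fin (M i) // (⟨i, j⟩ : Σ i, Fin (M i)) ∉ Z} := by
    intro i
    have h1 : Fintype.card {j : Fin (M i) // (⟨i, j⟩ : Σ i, Fin (M i)) ∈ Z} ≤ Z.ncard := by
      rw [← Nat.card_eq_fintype_card, ← Nat.card_coe_set_eq]
      refine Nat.card_le_card_of_injective (fun j => (⟨⟨i, j.1⟩, j.2⟩ : Z)) ?_
      intro j j' hjj
      simpa [Subtype.ext_iff] using hjj
    have h2 := Fintype.card_subtype_compl (fun j : Fin (M i) => (⟨i, j⟩ : Σ i, Fin (M i)) ∈ Z)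
    rw [Fintype.card_fin] at h2 ⊢
    have := h i
    omega
  let g := fun i => (Function.Embedding.nonempty_of_card_le (hcard i)).some
  refine ⟨⟨fun x => ⟨x.1, (g x.1 x.2).1⟩, ?_⟩, fun x => rfl, fun x => (g x.1 x.2).2⟩
  rintro ⟨i, x⟩ ⟨j, y⟩ hxy
  simp only [Sigma.mk.injEq] at hxy
  obtain ⟨rfl, hxy⟩ := hxy
  simp only [heq_eq_eq] at hxy
  rw [(g i).injective (Subtype.ext hxy)]

/-- The numerical content of the choice of `δ`. -/
lemma two_mul_card_bound_le {s k : ℕ} (hs : 0 < s) (hk : 0 < k) {α β ε : ℝ} (hα : 0 < α)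
    (hαβ : α ≤ β) (hε : 0 < ε) :
    (2 * (s ^ 2 * 8 ^ k)) * (ε / 2 * (α / (56 * (s : ℝ) ^ 3 * β)) ^ (2 * k)) ≤ ε / 2 ∧
      ε / 2 * (α / (56 * (s : ℝ) ^ 3 * β)) ^ (2 * k) ≤ ε / 2 := by
  have hs1 : (1 : ℝ) ≤ s := by exact_mod_cast hs
  have hβ : 0 < β := hα.trans_le hαβ
  have hs3 : (1 : ℝ) ≤ (s : ℝ) ^ 3 := one_le_pow₀ hs1
  set q := α / (56 * (s : ℝ) ^ 3 * β) with hq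
  have hq0 : 0 ≤ q := by positivity
  have hqs : q * (56 * (s : ℝ) ^ 3) ≤ 1 := by
    rw [hq, div_mul_eq_mul_div, div_le_one (by positivity)]
    nlinarith [mul_le_mul_of_nonneg_right hαβ (by positivity : (0 : ℝ) ≤ 56 * (s : ℝ) ^ 3)]
  have hqs' : q * (56 * (s : ℝ)) ≤ 1 := by
    refine le_trans (mul_le_mul_of_nonneg_left ?_ hq0) hqs
    have : (s : ℝ) ≤ (s : ℝ) ^ 3 := le_self_pow₀ hs1 (by norm_num)
    linarith
  have hsq : (s : ℝ) ^ 2 * q ^ 2 * 3136 ≤ 1 := by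
    have := pow_le_one₀ (n := 2) (by positivity) hqs'
    nlinarith
  have hq1 : q ≤ 1 := by nlinarith
  have h8 : 8 * q ^ 2 ≤ 1 := by
    have : q ^ 2 ≤ (s : ℝ) ^ 2 * q ^ 2 := le_mul_of_one_le_left (sq_nonneg q) (one_le_pow₀ hs1)
    linarith
  have hpow : (8 * q ^ 2) ^ k ≤ 8 * q ^ 2 :=
    pow_le_of_le_one (by positivity) h8 hk.ne'
  constructor
  · have h1 : (2 * (s ^ 2 * 8 ^ k)) * (ε / 2 * q ^ (2 * k)) =
        ε * ((s : ℝ) ^ 2 * (8 * q ^ 2) ^ k) := by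
      rw [mul_pow, ← pow_mul]
      ring
    rw [h1]
    have h2 : (s : ℝ) ^ 2 * (8 * q ^ 2) ^ k ≤ 1 / 2 := by
      have := mul_le_mul_of_nonneg_left hpow (sq_nonneg (s : ℝ))
      linarith
    nlinarith
  · have := pow_le_one₀ (n := 2 * k) hq0 hq1
    nlinarith

/-- Without colours, `G` has no edges, and the degree condition leaves no room for edges in the
blow-up with the smaller parts. -/
lemma blowUp_eq_bot_of_degree_le {s : ℕ} (F : LoopGraph (Fin s)) (N : Fin s → ℝ) {t : ℝ}
    (hN : ∀ i, 0 < N i) (ht : 0 ≤ t)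
    (hdeg : ∀ u, (((F.blowUp fun i => N i + t).neighborSet u).ncard : ℝ) ≤ t / 2) :
    F.blowUp N = ⊥ := by
  rw [eq_bot_iff]
  rintro x y ⟨hne, hF⟩
  have hceil : ∀ i, ⌈N i⌉₊ ≤ ⌈N i + t⌉₊ := fun i => Nat.ceil_mono (by linarith)
  let ι : (Σ i, Fin ⌈N i⌉₊) → Σ i, Fin ⌈N i + t⌉₊ := fun z => ⟨z.1, Fin.castLE (hceil _) z.2⟩
  have hι : ι x ≠ ι y := by
    intro h
    apply hne
    rcases x with ⟨i, x⟩
    rcases y with ⟨j, y⟩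
    simp only [ι, Sigma.mk.injEq] at h
    obtain ⟨rfl, h⟩ := h
    rw [Fin.castLE_injective _ (heq_iff_eq.1 h)]
  have hfin := Set.toFinite ((F.blowUp fun i => N i + t).neighborSet (ι x))
  have h1 : 1 ≤ ((F.blowUp fun i => N i + t).neighborSet (ι x)).ncard :=
    (Set.ncard_pos hfin).2 ⟨ι y, hι, hF⟩
  -- All vertices in the part of `y`, except possibly `x`, are neighbours of `x`.
  have h2 : ⌈N y.1 + t⌉₊ ≤ ((F.blowUp fun i => N i + t).neighborSet (ι x)).ncard + 1 := by
    have h3 : Set.range (fun j : Fin ⌈N y.1 + t⌉₊ => (⟨y.1, j⟩ : Σ i, Fin ⌈N i + t⌉₊)) ⊆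
        insert (ι x) ((F.blowUp fun i => N i + t).neighborSet (ι x)) := by
      rintro _ ⟨j, rfl⟩
      by_cases h : (⟨y.1, j⟩ : Σ i, Fin ⌈N i + t⌉₊) = ι x
      · exact Or.inl h
      · exact Or.inr ⟨fun h' => h h'.symm, hF⟩
    have h4 := (Set.ncard_le_ncard h3 (hfin.insert _)).trans (Set.ncard_insert_le _ _)
    rwa [← Set.image_univ, Set.ncard_image_of_injective _ (fun a b h => by simpa using h),
      Set.ncard_univ, Nat.card_fin] at h4
  have h5 := Nat.le_ceil (N y.1 + t)
  have h6 := hdeg (ι x)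
  have h7 : ((⌈N y.1 + t⌉₊ : ℕ) : ℝ) ≤
      (((F.blowUp fun i => N i + t).neighborSet (ι x)).ncard : ℝ) + 1 := by exact_mod_cast h2
  have h8 : (1 : ℝ) ≤ (((F.blowUp fun i => N i + t).neighborSet (ι x)).ncard : ℝ) := by
    exact_mod_cast h1
  have h9 := hN y.1
  linarith

/-- The colouring is pulled back along an injection `f` whose image contains no bad pair: an edge
takes its colour from `G` if it has one, and otherwise the colour of some saturated graph. -/
lemma exists_edgeLabeling_of_embedding {V W : Type*} {k : ℕ} {G : SimpleGraph V}
    (C : G.EdgeLabeling (Fin k)) (Hs : Fin k → SimpleGraph V) (hHs : ∀ ℓ, C.labelGraph ℓ ≤ Hs ℓ)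
    {B : SimpleGraph W} (f : W ↪ V)
    (hf : ∀ x y, B.Adj x y → ∃ ℓ, (Hs ℓ).Adj (f x) (f y)) :
    ∃ C' : B.EdgeLabeling (Fin k), (∀ ℓ x y, (C'.labelGraph ℓ).Adj x y → (Hs ℓ).Adj (f x) (f y)) ∧
      ∀ x y (h : G.Adj (f x) (f y)) (h' : B.Adj x y), C'.get x y h' = C.get (f x) (f y) h := by
  classical
  have hex : ∀ e : B.edgeSet, ∃ ℓ, ∀ x y, e.1 = s(x, y) →
      (Hs ℓ).Adj (f x) (f y) ∧ ∀ h : G.Adj (f x) (f y), ℓ = C.get (f x) (f y) h := by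
    rintro ⟨e, he⟩
    induction e using Sym2.inductionOn with
    | hf x y =>
      -- A property of the ordered pair `(x, y)` that is symmetric suffices.
      have hsymm : ∀ ℓ, ((Hs ℓ).Adj (f x) (f y) ∧
          ∀ h : G.Adj (f x) (f y), ℓ = C.get (f x) (f y) h) → ∀ x' y', s(x, y) = s(x', y') →
          (Hs ℓ).Adj (f x') (f y') ∧ ∀ h : G.Adj (f x') (f y'), ℓ = C.get (f x') (f y') h := by
        rintro ℓ ⟨h1, h2⟩ x' y' hxy
        rcases Sym2.eq_iff.1 hxy with ⟨rfl, rfl⟩ | ⟨rfl, rfl⟩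
        · exact ⟨h1, h2⟩
        · exact ⟨h1.symm, fun h => (h2 h.symm).trans (EdgeLabeling.get_comm _ _ _)⟩
      by_cases hG : G.Adj (f x) (f y)
      · refine ⟨C.get _ _ hG, hsymm _ ⟨hHs _ ?_, fun _ => rfl⟩⟩
        exact (EdgeLabeling.labelGraph_adj _ _).2 ⟨hG, rfl⟩
      · obtain ⟨ℓ, hℓ⟩ := hf x y he
        exact ⟨ℓ, hsymm ℓ ⟨hℓ, fun h => absurd h hG⟩⟩
  choose C' hC' using hex
  refine ⟨C', ?_, ?_⟩
  · intro ℓ x y h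
    obtain ⟨h1, rfl⟩ := (EdgeLabeling.labelGraph_adj _ _).1 h
    exact (hC' ⟨s(x, y), h1⟩ x y rfl).1
  · intro x y h h'
    exact (hC' ⟨s(x, y), h'⟩ x y rfl).2 h

theorem mainTheorem1 (κ : MatchingKind) (s k k₀ : ℕ) (hs : 0 < s) (hk : k₀ ≤ k)
    (α β : ℝ) (hα : 0 < α) (hαβ : α ≤ β) :
    ∃ ε₀ : ℝ, 0 < ε₀ ∧ ∀ ε δ : ℝ, 0 < ε → ε < ε₀ →
      δ = ε / 2 * (α / (56 * (s : ℝ) ^ 3 * β)) ^ (2 * k) →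
      ∀ (n : ℕ) (N : Fin s → ℝ) (a : Fin k → ℝ),
        (∀ i, 0 < N i ∧ N i ≤ β * n) → (∀ ℓ, α ≤ a ℓ) →
        ∀ (F : LoopGraph (Fin s))
          (G : SimpleGraph (Σ i : Fin s, Fin ⌈N i + ε * n⌉₊)) (C : G.EdgeLabeling (Fin k)),
          G ≤ F.blowUp (fun i => N i + ε * n) →
          (∀ u, (((F.blowUp (fun i => N i + ε * n)).neighborSet u).ncard : ℝ) - δ * n ≤
            ((G.neighborSet u).ncard : ℝ)) →
          AvoidsConnectedMatchings κ k₀ C (fun ℓ => a ℓ * n) →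
          ∃ C' : (F.blowUp N).EdgeLabeling (Fin k),
            AvoidsConnectedMatchings κ k₀ C' (fun ℓ => a ℓ * n) ∧
            -- The image of `f` consists of `⌈N i⌉` vertices of each blob `i`, and the subgraph of
            -- `G` induced by it is contained, with its colours, in the coloured graph `C'`.
            ∃ f : (Σ i : Fin s, Fin ⌈N i⌉₊) ↪ (Σ i : Fin s, Fin ⌈N i + ε * n⌉₊),
              (∀ x, (f x).1 = x.1) ∧
              ∀ x y, ∀ h : G.Adj (f x) (f y), ∃ h' : (F.blowUp N).Adj x y,
                C'.get x y h' = C.get (f x) (f y) h := by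
  classical
  refine ⟨1, one_pos, ?_⟩
  intro ε δ hε _ hδ n N a hN _ F G C hG hdeg havoid
  have hεn : 0 ≤ ε * n := by positivity
  set B := F.blowUp (fun i => N i + ε * n) with hB
  -- Any injection respecting the parts pulls edges of `G` back to edges of the smaller blow-up.
  have hback : ∀ f : (Σ i : Fin s, Fin ⌈N i⌉₊) ↪ (Σ i : Fin s, Fin ⌈N i + ε * n⌉₊),
      (∀ x, (f x).1 = x.1) → ∀ x y, G.Adj (f x) (f y) → (F.blowUp N).Adj x y := by
    intro f hf x y h
    obtain ⟨h1, h2⟩ := hG h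
    rw [hf, hf] at h2
    exact ⟨fun hxy => h1 (congrArg f hxy), h2⟩
  -- The saturated colours.
  choose Hs hle hsep hmatch using
    fun ℓ : Fin k => exists_saturation κ (C.labelGraph ℓ) (k₀ ≤ (ℓ : ℕ))
  -- The bad pairs.
  let J : SimpleGraph (Σ i : Fin s, Fin ⌈N i + ε * n⌉₊) :=
    { Adj := fun x y => B.Adj x y ∧ ∀ ℓ, ¬ (Hs ℓ).Adj x y
      symm := ⟨fun x y h => ⟨h.1.symm, fun ℓ h' => h.2 ℓ h'.symm⟩⟩
      loopless := ⟨fun x h => B.irrefl h.1⟩ }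
  suffices hmain : ∃ f : (Σ i : Fin s, Fin ⌈N i⌉₊) ↪ (Σ i : Fin s, Fin ⌈N i + ε * n⌉₊),
      (∀ x, (f x).1 = x.1) ∧ ∀ x y, (F.blowUp N).Adj x y → ¬ J.Adj (f x) (f y) by
    obtain ⟨f, hf1, hf2⟩ := hmain
    obtain ⟨C', hC', hget⟩ := exists_edgeLabeling_of_embedding C Hs hle (B := F.blowUp N) f (by
      intro x y hxy
      by_contra! h
      refine hf2 x y hxy ⟨⟨fun h' => hxy.1 (f.injective h'), ?_⟩, h⟩
      rw [hf1, hf1]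
      exact hxy.2)
    refine ⟨C', ⟨?_, ?_⟩, f, hf1, fun x y h => ⟨hback f hf1 x y h, hget x y h _⟩⟩
    · intro ℓ hℓ h
      exact havoid.1 ℓ hℓ ((hmatch ℓ _).1 (not_le.2 hℓ) (h.map ⟨f, hC' ℓ _ _⟩ f.injective))
    · intro ℓ hℓ h
      exact havoid.2 ℓ hℓ ((hmatch ℓ _).2 hℓ (h.map ⟨f, hC' ℓ _ _⟩ f.injective))
  rcases Nat.eq_zero_or_pos k with rfl | hk0
  · -- Without colours there are no edges at all.
    have hG0 : ∀ x y, ¬ G.Adj x y := fun x y h => (C.get x y h).elim0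
    have hbot : F.blowUp N = ⊥ := blowUp_eq_bot_of_degree_le F N (fun i => (hN i).1) hεn (by
      intro u
      have h1 := hdeg u
      have h2 : G.neighborSet u = ∅ := by
        ext v
        simp [hG0]
      rw [h2, Set.ncard_empty, hδ] at h1
      simp only [mul_zero, pow_zero, mul_one, Nat.cast_zero] at h1
      change ((B.neighborSet u).ncard : ℝ) ≤ _
      linarith)
    obtain ⟨f, hf, -⟩ := exists_embedding_avoiding (m := fun i => ⌈N i⌉₊)
      (M := fun i => ⌈N i + ε * n⌉₊) ∅ (fun i => by
        rw [Set.ncard_empty, add_zero]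
        exact Nat.ceil_mono (by linarith))
    refine ⟨f, hf, fun x y h => ?_⟩
    rw [hbot] at h
    exact h.elim
  have hJG : ∀ x y, J.Adj x y → ¬ G.Adj x y := fun x y h hxy =>
    h.2 _ (hle (C.get x y hxy) ((EdgeLabeling.labelGraph_adj _ _).2 ⟨hxy, rfl⟩))
  have hJdeg : ∀ u, ((J.neighborSet u).ncard : ℝ) ≤ δ * n := by
    intro u
    have h1 : J.neighborSet u ∪ G.neighborSet u ⊆ B.neighborSet u :=
      Set.union_subset (fun v hv => hv.1) (fun v hv => hG hv)
    have h2 := Set.ncard_le_ncard h1 (Set.toFinite _)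
    have hd : Disjoint (J.neighborSet u) (G.neighborSet u) :=
      Set.disjoint_left.2 fun v hv hv' => hJG _ _ hv hv'
    rw [Set.ncard_union_eq hd (Set.toFinite _) (Set.toFinite _)] at h2
    have h3 : ((J.neighborSet u).ncard : ℝ) + (G.neighborSet u).ncard ≤
        (B.neighborSet u).ncard := by exact_mod_cast h2
    linarith [hdeg u]
  obtain ⟨D, hD, hDJ⟩ := exists_finset_forall_adj_exists_adj J (ι := Option (Fin k))
    (R := fun o x y => o.elim (¬ F.Adj x.1 y.1) (fun ℓ => (Hs ℓ).Adj x y))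
    (c := fun o => o.elim (s ^ 2) (fun _ => 8)) (by
      rintro (_ | ℓ)
      · exact isRandomlySeparable_not_comp hs Sigma.fst F.Adj
      · exact hsep ℓ) (by
      intro x y
      rw [Option.forall]
      simp only [Option.elim, not_not]
      exact and_assoc)
  rw [Fintype.prod_option] at hD
  simp only [Option.elim, Finset.prod_const, Finset.card_univ, Fintype.card_fin] at hD
  obtain ⟨hnum1, hnum2⟩ := two_mul_card_bound_le (k := k) hs hk0 hα hαβ hε
  rw [← hδ] at hnum1 hnum2
  set Z : Set (Σ i : Fin s, Fin ⌈N i + ε * n⌉₊) := ⋃ u ∈ D, J.neighborSet u with hZ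
  have hZcard : (Z.ncard : ℝ) ≤ ε * n / 2 := by
    have h1 : Z.ncard ≤ ∑ u ∈ D, (J.neighborSet u).ncard := Finset.set_ncard_biUnion_le _ _
    have hδn : 0 ≤ δ * n := by
      rw [hδ]
      have : 0 < β := hα.trans_le hαβ
      positivity
    calc (Z.ncard : ℝ) ≤ ∑ u ∈ D, ((J.neighborSet u).ncard : ℝ) := by exact_mod_cast h1
      _ ≤ ∑ _u ∈ D, δ * n := Finset.sum_le_sum fun u _ => hJdeg u
      _ = D.card * (δ * n) := by rw [Finset.sum_const, nsmul_eq_mul]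
      _ ≤ (2 * (s ^ 2 * 8 ^ k)) * (δ * n) :=
          mul_le_mul_of_nonneg_right (by exact_mod_cast hD) hδn
      _ = (2 * (s ^ 2 * 8 ^ k)) * δ * n := by ring
      _ ≤ ε / 2 * n := mul_le_mul_of_nonneg_right hnum1 (by positivity)
      _ = ε * n / 2 := by ring
  -- If some vertex has to be avoided, then `1 ≤ δ n`, so that `ε n` absorbs the rounding.
  have hroom : ∀ i, ⌈N i⌉₊ + Z.ncard ≤ ⌈N i + ε * n⌉₊ := by
    intro i
    rcases Z.eq_empty_or_nonempty with h0 | ⟨z, hz⟩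
    · rw [h0, Set.ncard_empty, add_zero]
      exact Nat.ceil_mono (by linarith)
    · obtain ⟨u, -, hu⟩ := Set.mem_iUnion₂.1 hz
      have h1 : (1 : ℝ) ≤ (J.neighborSet u).ncard := by
        exact_mod_cast (Set.ncard_pos (Set.toFinite _)).2 ⟨z, hu⟩
      have h2 : δ * n ≤ ε / 2 * n := mul_le_mul_of_nonneg_right hnum2 (by positivity)
      have h3 := Nat.ceil_lt_add_one (hN i).1.le
      have h4 := Nat.le_ceil (N i + ε * n)
      have h5 := hJdeg u
      have h6 : ((⌈N i⌉₊ + Z.ncard : ℕ) : ℝ) ≤ (⌈N i + ε * n⌉₊ : ℕ) := by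
        push_cast
        linarith
      exact_mod_cast h6
  obtain ⟨f, hf1, hf2⟩ := exists_embedding_avoiding Z hroom
  refine ⟨f, hf1, fun x y _ hxy => ?_⟩
  obtain ⟨u, hu, h | h⟩ := hDJ _ _ hxy
  · exact hf2 x (Set.mem_iUnion₂.2 ⟨u, hu, h⟩)
  · exact hf2 y (Set.mem_iUnion₂.2 ⟨u, hu, h⟩)
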